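/- Let $\Omega=\{(u,v)\in\mathbb R^2 : u^2+v^2<1\}$ and let $f$ be a $C^\infty$ map into $\mathbb R^3$ defined on an open neighbourhood of $\overline\Omega$. Assume that at every point of $\overline\Omega$ the map $f$ is an immersion, the coordinate directions $f_u$ and $f_v$ are principal directions (that is, $f$ is parametrized by curvature lines), and the point is not umbilic (the two principal curvatures are different). Then there are constants $C>0$ and $\varepsilon_0>0$, depending only on $f$, such that for every $\varepsilon\in(0,\varepsilon_0)$ and every base point $(u_0,v_0)\in\Omega$ the following holds. Put $f_{ij}=f(u_0+i\varepsilon,\,v_0+j\varepsilon)$ for $(i,j)\in D_\varepsilon=\{(i,j)\in\mathbb Z^2 : (u_0+i\varepsilon,\,v_0+j\varepsilon)\in\Omega\}$. There are points $f^\varepsilon_{ij}\in\mathbb R^3$, $(i,j)\in D_\varepsilon$, which form a discrete circular net, i.e. whenever $(i,j),(i+1,j),(i,j+1),(i+1,j+1)$ all belong to $D_\varepsilon$, the four points $f^\varepsilon_{ij},f^\varepsilon_{i+1,j},f^\varepsilon_{i+1,j+1},f^\varepsilon_{i,j+1}$ lie on a common circle, and which satisfy, for all $(i,j)\in D_\varepsilon$,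 $$f^\varepsilon_{ij}\in f(\Omega)\qquad\text{and}\qquad d(f_{ij},f^\varepsilon_{ij})\le C\varepsilon^2 .$$ -/

import Mathlib

open scoped ContDiff

namespace CurvNet

/-- Euclidean three-space. -/
abbrev E3 : Type := EuclideanSpace ℝ (Fin 3)

/-- The open unit disc of the parameter plane with coordinates `(u, v)`. -/
def unitDisc : Set (ℝ × ℝ) := {p | p.1 ^ 2 + p.2 ^ 2 < 1}

/-- The closed unit disc of the parameter plane. -/
def closedUnitDisc : Set (ℝ × ℝ) := {p | p.1 ^ 2 + p.2 ^ 2 ≤ 1}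

/-- The cross product of two vectors of Euclidean three-space. -/
noncomputable def cross (a b : E3) : E3 :=
  WithLp.toLp 2 (crossProduct (WithLp.ofLp a) (WithLp.ofLp b))

/-- The unit normal `(f_u × f_v) / |f_u × f_v|` (meaningful where `f` is an immersion). -/
noncomputable def unitNormal (f : ℝ × ℝ → E3) (p : ℝ × ℝ) : E3 :=
  let n := cross (fderiv ℝ f p (1, 0)) (fderiv ℝ f p (0, 1))
  ‖n‖⁻¹ • n

/-- The first fundamental form of `f` at `p`. -/
noncomputable def firstForm (f : ℝ × ℝ → E3) (p X Y : ℝ × ℝ) : ℝ :=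
  inner ℝ (fderiv ℝ f p X) (fderiv ℝ f p Y)

/-- The second fundamental form of `f` at `p`: the normal component of the second
derivative of `f` in the directions `X` and `Y`. -/
noncomputable def secondForm (f : ℝ × ℝ → E3) (p X Y : ℝ × ℝ) : ℝ :=
  inner ℝ (fderiv ℝ (fun q => fderiv ℝ f q Y) p X) (unitNormal f p)

/-- `X` is a principal direction at `p` (an eigenvector of the shape operator). -/
def IsPrincipalDirection (f : ℝ × ℝ → E3) (p X : ℝ × ℝ) : Prop :=
  X ≠ 0 ∧ ∃ κ : ℝ, ∀ Y : ℝ × ℝ, secondForm f p X Y = κ * firstForm f p X Y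

/-- `p` is an umbilic point: the two fundamental forms are proportional, that is, the two
principal curvatures coincide. -/
def IsUmbilic (f : ℝ × ℝ → E3) (p : ℝ × ℝ) : Prop :=
  ∃ κ : ℝ, ∀ X Y : ℝ × ℝ, secondForm f p X Y = κ * firstForm f p X Y

/-- On `S` the map `f` is an immersion whose coordinate lines are curvature lines, that is,
are everywhere tangent to principal directions. -/
def IsCurvatureLineParametrization (f : ℝ × ℝ → E3) (S : Set (ℝ × ℝ)) : Prop :=
  ∀ p ∈ S, Function.Injective (fderiv ℝ f p) ∧
    IsPrincipalDirection f p (1, 0) ∧ IsPrincipalDirection f p (0, 1)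

/-- The node `(u₀ + i ε, v₀ + j ε)` of the square grid of mesh `ε` through `p₀ = (u₀, v₀)`. -/
def gridPoint (p₀ : ℝ × ℝ) (ε : ℝ) (i j : ℤ) : ℝ × ℝ :=
  (p₀.1 + i * ε, p₀.2 + j * ε)

/-- The map `F`, regarded on the index set `D`, is a discrete circular net: the four vertices
of every elementary quadrangle with all its vertices in `D` lie on a circle. -/
def IsCircularNetOn (D : Set (ℤ × ℤ)) (F : ℤ → ℤ → E3) : Prop :=
  ∀ i j : ℤ, (i, j) ∈ D → (i + 1, j) ∈ D → (i, j + 1) ∈ D → (i + 1, j + 1) ∈ D →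
    EuclideanGeometry.Concyclic
      ({F i j, F (i + 1) j, F (i + 1) (j + 1), F i (j + 1)} : Set E3)

end CurvNet

/-! The net is sought as `f` evaluated on a parameter grid whose nodes are displaced by `h ^ 2 • w i
j`, where `h` is half the mesh. Its vertices lie on the surface and are O(ε²) away from the given
ones as soon as `w` is bounded, so the task is to find a bounded `w` that makes every elementary
quadrilateral concyclic.

A quadrilateral with independent bimedians is concyclic if it is planar and one further polynomial
vanishes (`concyclic_of_defects_eq_zero`). For a quadrilateral inscribed in the surface, with
parameter bimedians along `U` and `V`, both defects extend to smooth even functions of `h`, so they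
differ from their values at `h = 0` by `h ^ 2` times a smooth function (`exists_smooth_defects`).
Along curvature lines the net is orthogonal and conjugate, and these leading values become, up to
nonvanishing factors, two linear forms in `U.1 * V.1` and `U.2 * V.2`. Their determinant is nonzero
because there are no umbilics. Solving gives `V.1 = h ^ 2 * R₁` and `U.2 = h ^ 2 * R₂` with
Lipschitz `R₁`, `R₂` (`exists_lipschitz_circularity`).

For `w` this is a lattice Goursat problem with zero data on the axes. A transversal difference `d`
of `w` satisfies `d (i + 1) + d i = 4 h R`. The alternating sign is what saves the estimate: two
steps give `d (i + 2) - d i = 4 h (R - R')`, which is O(h²) by the Lipschitz property. Hence `d`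
stays O(h) and `w` stays bounded over O(1/h) steps (`goursat_bound`, `exists_lattice_displacement`).
The grid is also contracted by a factor 1 - O(ε²), so that displaced nodes do not leave the disc. -/

namespace CurvNet

/-! ### Hadamard's lemma with parameters. -/

section Hadamard

variable {X F : Type} [NormedAddCommGroup X] [NormedSpace ℝ X] [FiniteDimensional ℝ X]
  [NormedAddCommGroup F] [NormedSpace ℝ F]

theorem hasFDerivAt_unitIntegral {G : X × ℝ → F} (hG : ContDiff ℝ 1 G) (x₀ : X) :
    HasFDerivAt (fun x => ∫ t in (0:ℝ)..1, G (x, t))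
      (∫ t in (0:ℝ)..1, (fderiv ℝ G (x₀, t)).comp (ContinuousLinearMap.inl ℝ X ℝ)) x₀ := by
  have hc : Continuous G := hG.continuous
  have hd : Continuous fun q : X × ℝ => (fderiv ℝ G q).comp (ContinuousLinearMap.inl ℝ X ℝ) :=
    (hG.continuous_fderiv one_ne_zero).clm_comp continuous_const
  have hK : IsCompact (Metric.closedBall x₀ 1 ×ˢ Set.Icc (0:ℝ) 1) :=
    (isCompact_closedBall x₀ 1).prod isCompact_Icc
  obtain ⟨B, hB⟩ := hK.exists_bound_of_continuousOn hd.continuousOn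
  refine (intervalIntegral.hasFDerivAt_integral_of_dominated_of_fderiv_le
    (F' := fun x t => (fderiv ℝ G (x, t)).comp (ContinuousLinearMap.inl ℝ X ℝ))
    (bound := fun _ => B) (s := Metric.ball x₀ 1) (Metric.ball_mem_nhds x₀ one_pos)
    ?_ ?_ ?_ ?_ ?_ ?_)
  · exact Filter.Eventually.of_forall fun x => (by fun_prop : Continuous fun t => G (x, t)).aestronglyMeasurable
  · exact (by fun_prop : Continuous fun t => G (x₀, t)).intervalIntegrable _ _
  · exact (hd.comp (by fun_prop : Continuous fun t : ℝ => (x₀, t))).aestronglyMeasurable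
  · refine Filter.Eventually.of_forall fun t ht x hx => hB (x, t) ⟨Metric.ball_subset_closedBall hx, ?_⟩
    rw [Set.uIoc_of_le zero_le_one] at ht
    exact Set.Ioc_subset_Icc_self ht
  · exact intervalIntegrable_const
  · refine Filter.Eventually.of_forall fun t _ x _ => ?_
    exact ((hG.differentiable one_ne_zero (x, t)).hasFDerivAt).comp x (hasFDerivAt_prodMk_left x t)

/-- The derivative is an integral of the same kind with values in `X →L[ℝ] F`, so the induction on
`n` must leave `F` free. -/
theorem contDiff_unitIntegral_nat (n : ℕ) : ∀ {F : Type} [NormedAddCommGroup F] [NormedSpace ℝ F]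
    [CompleteSpace F] {G : X × ℝ → F}, ContDiff ℝ n G →
    ContDiff ℝ n (fun x => ∫ t in (0:ℝ)..1, G (x, t)) := by
  induction n with
  | zero =>
    intro F _ _ _ G hG
    rw [Nat.cast_zero, contDiff_zero] at hG ⊢
    exact intervalIntegral.continuous_parametric_intervalIntegral_of_continuous'
      (f := fun x t => G (x, t)) (by simpa [Function.uncurry_def] using hG) _ _
  | succ n ih =>
    intro F _ _ _ G hG
    have h1 : ContDiff ℝ 1 G := hG.of_le (by exact_mod_cast Nat.le_add_left 1 n)
    have hder := fun x => hasFDerivAt_unitIntegral h1 x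
    rw [Nat.cast_add, Nat.cast_one, contDiff_succ_iff_fderiv] at hG ⊢
    refine ⟨fun x => (hder x).differentiableAt, by simp, ?_⟩
    rw [funext fun x => (hder x).fderiv]
    exact ih (hG.2.2.clm_comp contDiff_const)

theorem contDiff_unitIntegral [CompleteSpace F] {G : X × ℝ → F} (hG : ContDiff ℝ ∞ G) :
    ContDiff ℝ ∞ (fun x => ∫ t in (0:ℝ)..1, G (x, t)) := by
  rw [contDiff_infty] at hG ⊢
  exact fun n => contDiff_unitIntegral_nat n (hG n)

/-- Hadamard's lemma with parameters: a smooth function vanishing at `h = 0` is `h` times a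
smooth function, whose value at `h = 0` is the `h`-derivative. -/
theorem exists_smooth_quotient [CompleteSpace F] {G : X × ℝ → F} (hG : ContDiff ℝ ∞ G) (h0 : ∀ x, G (x, 0) = 0) :
    ∃ H : X × ℝ → F, ContDiff ℝ ∞ H ∧ (∀ x h, G (x, h) = h • H (x, h)) ∧
      ∀ x, HasDerivAt (fun h => G (x, h)) (H (x, 0)) 0 := by
  have hdG : ContDiff ℝ ∞ (fderiv ℝ G) := hG.fderiv_right (by simp)
  -- Fundamental theorem of calculus on the segment from `(x, 0)` to `(x, h)`, rescaled to `[0, 1]`.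
  let H : X × ℝ → F := fun q => ∫ t in (0:ℝ)..1, fderiv ℝ G (q.1, t * q.2) (0, 1)
  have hH : ContDiff ℝ ∞ H := by
    refine contDiff_unitIntegral (X := X × ℝ)
      (G := fun q : (X × ℝ) × ℝ => fderiv ℝ G (q.1.1, q.2 * q.1.2) (0, 1)) ?_
    exact (hdG.comp (by fun_prop : ContDiff ℝ ∞ fun q : (X × ℝ) × ℝ =>
      (q.1.1, q.2 * q.1.2))).clm_apply contDiff_const
  have hd : ∀ x h, HasDerivAt (fun h => G (x, h)) (fderiv ℝ G (x, h) (0, 1)) h := fun x h =>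
    ((hG.differentiable (by simp) (x, h)).hasFDerivAt).comp_hasDerivAt h
      ((hasDerivAt_const h x).prodMk (hasDerivAt_id h))
  refine ⟨H, hH, fun x h => ?_, fun x => ?_⟩
  · have hint : ∫ t in (0:ℝ)..1, h • fderiv ℝ G (x, t * h) (0, 1) = G (x, 1 * h) - G (x, 0 * h) := by
      refine intervalIntegral.integral_eq_sub_of_hasDerivAt (f := fun t => G (x, t * h)) ?_ ?_
      · intro t _
        exact (hd x (t * h)).scomp t (by simpa using (hasDerivAt_id t).mul_const h)
      · refine Continuous.intervalIntegrable ?_ _ _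
        exact continuous_const.smul ((hdG.continuous.comp (by fun_prop :
          Continuous fun t : ℝ => (x, t * h))).clm_apply continuous_const)
    rw [intervalIntegral.integral_smul] at hint
    simpa [h0] using hint.symm
  · have : H (x, 0) = fderiv ℝ G (x, 0) (0, 1) := by simp [H]
    rw [this]
    exact hd x 0

/-- A smooth function that is even in `h` equals its value at `h = 0` up to `h ^ 2` times a
smooth function. -/
theorem exists_smooth_sq_quotient_of_even [CompleteSpace F] {G : X × ℝ → F} (hG : ContDiff ℝ ∞ G)
    (heven : ∀ x h, G (x, -h) = G (x, h)) :
    ∃ H : X × ℝ → F, ContDiff ℝ ∞ H ∧ ∀ x h, G (x, h) = G (x, 0) + h ^ 2 • H (x, h) := by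
  obtain ⟨A, hA, hGA, hder⟩ := exists_smooth_quotient (G := fun q : X × ℝ => G q - G (q.1, 0))
    (hG.sub (hG.comp (by fun_prop))) (by simp)
  -- The derivative at 0 of an even function equals its own negative; this allows a second division
  -- by `h`.
  have hA0 : ∀ x, A (x, 0) = 0 := by
    intro x
    have h1 := hder x
    have h2 : HasDerivAt (fun h => G (x, h) - G (x, 0)) (-A (x, 0)) 0 := by
      have h3 := HasDerivAt.scomp (h := fun h : ℝ => -h) (0 : ℝ) (by simpa using h1) (hasDerivAt_neg 0)
      simpa [Function.comp_def, heven] using h3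
    have h4 := h1.unique h2
    have h5 : (2 : ℝ) • A (x, 0) = 0 := by rw [two_smul]; nth_rewrite 2 [h4]; exact add_neg_cancel _
    exact (smul_eq_zero.1 h5).resolve_left two_ne_zero
  obtain ⟨H, hH, hAH, -⟩ := exists_smooth_quotient hA hA0
  refine ⟨H, hH, fun x h => ?_⟩
  have := hGA x h
  rw [hAH, smul_smul, ← pow_two] at this
  rw [← this]
  abel

end Hadamard

/-! ### Concyclicity as two polynomial equations. -/

/-- The scalar triple product in coordinates. -/
def triple (a b c : E3) : ℝ :=
  a 0 * (b 1 * c 2 - b 2 * c 1) + a 1 * (b 2 * c 0 - b 0 * c 2) + a 2 * (b 0 * c 1 - b 1 * c 0)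

/-- The scalar product in coordinates. -/
def dot (a b : E3) : ℝ := a 0 * b 0 + a 1 * b 1 + a 2 * b 2

theorem inner_eq_dot (a b : E3) : inner ℝ a b = dot a b := by
  simp [dot, PiLp.inner_apply, Fin.sum_univ_three, mul_comm]

theorem inner_cross (a b c : E3) : inner ℝ c (cross a b) = triple a b c := by
  simp [triple, cross, PiLp.inner_apply, Fin.sum_univ_three, cross_apply]
  ring

theorem dist_sq_eq (a b : E3) : dist a b ^ 2 = dot (a - b) (a - b) := by
  rw [dist_eq_norm, ← real_inner_self_eq_norm_sq, inner_eq_dot]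

/-- The Gram determinant of two vectors. -/
def gram (a b : E3) : ℝ := dot a a * dot b b - dot a b ^ 2

/-- The obstruction to cosphericity of a planar quadrilateral with bimedians `2 X`, `2 Y` and
mixed difference `4 Z`, in a form where the mesh `h` is scaled out. -/
def circDefect (h : ℝ) (X Y Z : E3) : ℝ :=
  dot X Y * gram X Y - h ^ 2 * ((dot X X + dot Y Y) * (dot X Z * dot Y Z)
    - dot X Y * (dot X Z ^ 2 + dot Y Z ^ 2))

/-- Expanding `Z` in the frame `X`, `Y`, `X × Y`, the coefficient of the normal is a multiple of the
triple product. -/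
theorem eq_combination_of_triple_eq_zero {X Y Z : E3} (hg : gram X Y ≠ 0) (ht : triple X Y Z = 0) :
    Z = ((dot Y Y * dot X Z - dot X Y * dot Y Z) / gram X Y) • X
      + ((dot X X * dot Y Z - dot X Y * dot X Z) / gram X Y) • Y := by
  have key : ∀ k : Fin 3, gram X Y * Z k = (dot Y Y * dot X Z - dot X Y * dot Y Z) * X k
      + (dot X X * dot Y Z - dot X Y * dot X Z) * Y k := by
    have h0 : gram X Y * Z 0 = (dot Y Y * dot X Z - dot X Y * dot Y Z) * X 0
      + (dot X X * dot Y Z - dot X Y * dot X Z) * Y 0 + triple X Y Z * (X 1 * Y 2 - X 2 * Y 1) := by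
      simp only [gram, dot, triple]; ring
    have h1 : gram X Y * Z 1 = (dot Y Y * dot X Z - dot X Y * dot Y Z) * X 1
      + (dot X X * dot Y Z - dot X Y * dot X Z) * Y 1 + triple X Y Z * (X 2 * Y 0 - X 0 * Y 2) := by
      simp only [gram, dot, triple]; ring
    have h2 : gram X Y * Z 2 = (dot Y Y * dot X Z - dot X Y * dot Y Z) * X 2
      + (dot X X * dot Y Z - dot X Y * dot X Z) * Y 2 + triple X Y Z * (X 0 * Y 1 - X 1 * Y 0) := by
      simp only [gram, dot, triple]; ring
    rw [ht] at h0 h1 h2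
    intro k
    fin_cases k
    · simpa using h0
    · simpa using h1
    · simpa using h2
  ext k
  have := key k
  simp only [PiLp.add_apply, PiLp.smul_apply, smul_eq_mul]
  field_simp
  linarith

/-- The centre is `m + a • X + b • Y`. The squared distance from it to `m + s X + t Y + s t Z`, with
`s, t = ± 1`, has coefficients at `s`, `t` and `s t` that must vanish: `h1` and `h2` are the first
two, and `h3` gives the third because `Z` lies in the plane of `X` and `Y`. -/
theorem concyclic_of_combination {m X Y Z : E3} {l μ a b : ℝ} (hZ : Z = l • X + μ • Y)
    (h1 : a * dot X X + b * dot X Y = dot Y Z) (h2 : a * dot X Y + b * dot Y Y = dot X Z)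
    (h3 : l * dot Y Z + μ * dot X Z = dot X Y) :
    EuclideanGeometry.Concyclic
      ({m - X - Y + Z, m + X - Y - Z, m + X + Y + Z, m - X + Y - Z} : Set E3) := by
  have hZc : a * dot X Z + b * dot Y Z = dot X Y := by
    have e1 : dot X Z = l * dot X X + μ * dot X Y := by rw [hZ]; simp [dot]; ring
    have e2 : dot Y Z = l * dot X Y + μ * dot Y Y := by rw [hZ]; simp [dot]; ring
    rw [← h3]
    linear_combination a * e1 + b * e2 + l * h1 + μ * h2
  constructor
  · refine ⟨m + a • X + b • Y, dist (m - X - Y + Z) (m + a • X + b • Y), ?_⟩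
    have key : ∀ s t : ℝ, s ^ 2 = 1 → t ^ 2 = 1 →
        dist (m + s • X + t • Y + (s * t) • Z) (m + a • X + b • Y) ^ 2
        = dot X X + dot Y Y + dot Z Z + dot (a • X + b • Y) (a • X + b • Y) := by
      intro s t hs ht
      have : dist (m + s • X + t • Y + (s * t) • Z) (m + a • X + b • Y) ^ 2
        = s ^ 2 * dot X X + t ^ 2 * dot Y Y + s ^ 2 * t ^ 2 * dot Z Z
          + dot (a • X + b • Y) (a • X + b • Y)
          + 2 * (s * t) * (dot X Y - (a * dot X Z + b * dot Y Z))
          + 2 * t * (s ^ 2 * dot X Z - (a * dot X Y + b * dot Y Y))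
          + 2 * s * (t ^ 2 * dot Y Z - (a * dot X X + b * dot X Y)) := by
        rw [dist_sq_eq]
        simp only [dot, PiLp.add_apply, PiLp.sub_apply, PiLp.smul_apply, smul_eq_mul]
        ring
      rw [this, hs, ht, hZc, h1, h2]; ring
    have key2 : ∀ s t : ℝ, s ^ 2 = 1 → t ^ 2 = 1 →
        dist (m + s • X + t • Y + (s * t) • Z) (m + a • X + b • Y)
        = dist (m - X - Y + Z) (m + a • X + b • Y) := by
      intro s t hs ht
      rw [← sq_eq_sq₀ dist_nonneg dist_nonneg, key s t hs ht]
      have := key (-1) (-1) (by norm_num) (by norm_num)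
      rw [← this]
      congr 2
      module
    rintro p (rfl | rfl | rfl | rfl)
    · rfl
    · rw [← key2 1 (-1) (by norm_num) (by norm_num)]; congr 1; module
    · rw [← key2 1 1 (by norm_num) (by norm_num)]; congr 1; module
    · rw [← key2 (-1) 1 (by norm_num) (by norm_num)]; congr 1; module
  · have hsub : vectorSpan ℝ ({m - X - Y + Z, m + X - Y - Z, m + X + Y + Z, m - X + Y - Z} : Set E3)
        ≤ Submodule.span ℝ (Set.range ![X, Y]) := by
      have hX : X ∈ Submodule.span ℝ (Set.range ![X, Y]) := Submodule.subset_span ⟨0, rfl⟩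
      have hY : Y ∈ Submodule.span ℝ (Set.range ![X, Y]) := Submodule.subset_span ⟨1, rfl⟩
      have hc : ∀ s t : ℝ, s • X + t • Y ∈ Submodule.span ℝ (Set.range ![X, Y]) := fun s t =>
        Submodule.add_mem _ (Submodule.smul_mem _ _ hX) (Submodule.smul_mem _ _ hY)
      rw [vectorSpan_eq_span_vsub_set_right ℝ (Set.mem_insert _ _), Submodule.span_le]
      rintro v ⟨p, (rfl | rfl | rfl | rfl), rfl⟩
      · simp
      · refine (congrArg (· ∈ Submodule.span ℝ (Set.range ![X, Y])) ?_).mpr (hc (2 - 2 * l) (-2 * μ)); simp only [vsub_eq_sub, hZ]; module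
      · refine (congrArg (· ∈ Submodule.span ℝ (Set.range ![X, Y])) ?_).mpr (hc 2 2); simp only [vsub_eq_sub]; module
      · refine (congrArg (· ∈ Submodule.span ℝ (Set.range ![X, Y])) ?_).mpr (hc (-2 * l) (2 - 2 * μ)); simp only [vsub_eq_sub, hZ]; module
    rw [coplanar_iff_finrank_le_two]
    refine (Submodule.finrank_mono hsub).trans ?_
    exact finrank_range_le_card (R := ℝ) ![X, Y]

/-- A quadrilateral with bimedians `2 h X`, `2 h Y` and mixed difference `4 h ^ 2 Z` is
concyclic as soon as two polynomial expressions vanish. -/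
theorem concyclic_of_defects_eq_zero {m X Y Z : E3} {h : ℝ} (hg : gram X Y ≠ 0)
    (ht : triple X Y Z = 0) (hc : circDefect h X Y Z = 0) :
    EuclideanGeometry.Concyclic
      ({m - h • X - h • Y + h ^ 2 • Z, m + h • X - h • Y - h ^ 2 • Z,
        m + h • X + h • Y + h ^ 2 • Z, m - h • X + h • Y - h ^ 2 • Z} : Set E3) := by
  have hZ := eq_combination_of_triple_eq_zero hg ht
  set l := (dot Y Y * dot X Z - dot X Y * dot Y Z) / gram X Y with hl
  set μ := (dot X X * dot Y Z - dot X Y * dot X Z) / gram X Y with hμ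
  have hs : ∀ (r s : ℝ) (A B : E3), dot (r • A) (s • B) = r * s * dot A B := by
    intro r s A B; simp [dot]; ring
  -- `a` and `b` come from Cramer's rule for the first two equations; the third is then `circDefect`
  -- divided by the Gram determinant.
  refine concyclic_of_combination (l := h * l) (μ := h * μ)
    (a := h * ((dot Y Y * dot Y Z - dot X Y * dot X Z) / gram X Y))
    (b := h * ((dot X X * dot X Z - dot X Y * dot Y Z) / gram X Y)) ?_ ?_ ?_ ?_
  · conv_lhs => rw [hZ]
    module
  · simp only [hs]
    field_simp
    simp only [gram]; ring
  · simp only [hs]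
    field_simp
    simp only [gram]; ring
  · simp only [hs, hl, hμ]
    simp only [circDefect] at hc
    field_simp
    linear_combination (-h ^ 2) * hc

/-! ### Displaced cells and the lattice Goursat problem. -/

/-- The data `(c, U, V, T)` of the parameter quadrilateral with vertices
`c + s h U + t h V + s t h ^ 2 T`, `s, t = ± 1`. -/
abbrev QuadData : Type := (ℝ × ℝ) × (ℝ × ℝ) × (ℝ × ℝ) × (ℝ × ℝ)

/-- The data of the coordinate square with centre `c`, together with the half mesh `h`. -/
def squareData (h : ℝ) (c : ℝ × ℝ) : QuadData × ℝ := ((c, (1, 0), (0, 1), 0), h)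

/-- The data of the coordinate square with centre `c` and half mesh `h` after its vertices have
been displaced by `h ^ 2 w`. -/
noncomputable def cellData (h : ℝ) (c w₀₀ w₁₀ w₀₁ w₁₁ : ℝ × ℝ) : QuadData × ℝ :=
  ((c + (h ^ 2 / 4) • (w₀₀ + w₁₀ + w₀₁ + w₁₁), (1, 0) + (h / 4) • (w₁₀ + w₁₁ - w₀₀ - w₀₁),
    (0, 1) + (h / 4) • (w₀₁ + w₁₁ - w₀₀ - w₁₀), (1 / 4 : ℝ) • (w₁₁ - w₁₀ - w₀₁ + w₀₀)), h)

/-- Centre, `U` and `V` are close to the square because displacements enter them with a factor `h`.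
The mixed term `T` has no such factor, which is why the transversal differences must be controlled
separately by `δ`. -/
theorem dist_cellData_squareData_le {h m δ : ℝ} (hh : 0 ≤ h) (hh1 : h ≤ 1) {c w₀₀ w₁₀ w₀₁ w₁₁ : ℝ × ℝ}
    (h00 : ‖w₀₀‖ ≤ m) (h10 : ‖w₁₀‖ ≤ m) (h01 : ‖w₀₁‖ ≤ m) (h11 : ‖w₁₁‖ ≤ m)
    (d1 : |w₀₁.1 - w₀₀.1| ≤ δ) (d2 : |w₁₁.1 - w₁₀.1| ≤ δ)
    (d3 : |w₁₀.2 - w₀₀.2| ≤ δ) (d4 : |w₁₁.2 - w₀₁.2| ≤ δ) :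
    dist (cellData h c w₀₀ w₁₀ w₀₁ w₁₁) (squareData h c) ≤ h * m + δ := by
  have hm : 0 ≤ m := (norm_nonneg _).trans h00
  have hδ : 0 ≤ δ := (abs_nonneg _).trans d1
  have hhm := mul_nonneg hh hm
  simp only [Prod.norm_def, sup_le_iff, Real.norm_eq_abs, abs_le] at h00 h10 h01 h11
  rw [abs_le] at d1 d2 d3 d4
  have key : ∀ x : ℝ, |x| ≤ 4 * m → |h / 4 * x| ≤ h * m + δ := by
    intro x hx
    rw [abs_mul, abs_of_nonneg (by positivity)]
    nlinarith
  have key2 : ∀ x : ℝ, |x| ≤ 4 * m → |h ^ 2 / 4 * x| ≤ h * m + δ := by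
    intro x hx
    rw [abs_mul, abs_of_nonneg (by positivity)]
    nlinarith [mul_nonneg (sq_nonneg h) (sub_nonneg.2 hx), mul_nonneg hhm (sub_nonneg.2 hh1)]
  rw [dist_eq_norm]
  simp only [cellData, squareData, Prod.mk_sub_mk, Prod.norm_def, sup_le_iff, Real.norm_eq_abs,
    Prod.fst_add, Prod.snd_add, Prod.fst_sub, Prod.snd_sub, Prod.smul_fst, Prod.smul_snd,
    smul_eq_mul, add_sub_cancel_left, sub_self, abs_zero, sub_zero]
  refine ⟨⟨⟨key2 _ ?_, key2 _ ?_⟩, ⟨key _ ?_, key _ ?_⟩, ⟨key _ ?_, key _ ?_⟩, ?_, ?_⟩, by positivity⟩ <;>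
    (rw [abs_le]; constructor <;> linarith)

theorem dist_cellData_le {h : ℝ} (hh : 0 ≤ h) (hh1 : h ≤ 1) (c w₀₀ w₁₀ w₀₁ v w : ℝ × ℝ) :
    dist (cellData h c w₀₀ w₁₀ w₀₁ v) (cellData h c w₀₀ w₁₀ w₀₁ w) ≤ 1 / 4 * dist v w := by
  have h1 : |v.1 - w.1| ≤ dist v w := by
    rw [dist_eq_norm]; exact norm_fst_le (v - w)
  have h2 : |v.2 - w.2| ≤ dist v w := by
    rw [dist_eq_norm]; exact norm_snd_le (v - w)
  have hd : 0 ≤ dist v w := dist_nonneg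
  have key : ∀ k y z x : ℝ, 0 ≤ k → k ≤ 1 / 4 → |x| ≤ dist v w → y - z = k * x →
      |y - z| ≤ 1 / 4 * dist v w := by
    intro k y z x hk hk1 hx e
    rw [e, abs_mul, abs_of_nonneg hk]
    nlinarith [abs_nonneg x]
  have hq : h ^ 2 / 4 ≤ 1 / 4 := by nlinarith
  rw [dist_eq_norm (cellData _ _ _ _ _ _)]
  simp only [cellData, Prod.mk_sub_mk, Prod.norm_def, sup_le_iff, Real.norm_eq_abs,
    Prod.fst_add, Prod.snd_add, Prod.fst_sub, Prod.snd_sub, Prod.smul_fst, Prod.smul_snd,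
    smul_eq_mul, sub_self, abs_zero]
  refine ⟨⟨⟨key (h ^ 2 / 4) _ _ _ (by positivity) hq h1 (by ring),
    key (h ^ 2 / 4) _ _ _ (by positivity) hq h2 (by ring)⟩,
    ⟨key (h / 4) _ _ _ (by positivity) (by linarith) h1 (by ring),
      key (h / 4) _ _ _ (by positivity) (by linarith) h2 (by ring)⟩,
    ⟨key (h / 4) _ _ _ (by positivity) (by linarith) h1 (by ring),
      key (h / 4) _ _ _ (by positivity) (by linarith) h2 (by ring)⟩,
    key (1 / 4) _ _ _ (by norm_num) le_rfl h1 (by ring),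
    key (1 / 4) _ _ _ (by norm_num) le_rfl h2 (by ring)⟩, by positivity⟩

/-- Three displaced vertices determine the fourth one. -/
theorem exists_fourth_vertex {R₁ R₂ : QuadData × ℝ → ℝ} {Λ : NNReal} (hR₁ : LipschitzWith Λ R₁)
    (hR₂ : LipschitzWith Λ R₂) {h : ℝ} (hh : 0 ≤ h) (hh1 : h ≤ 1) (hΛ : h * Λ < 1)
    (c w₀₀ w₁₀ w₀₁ : ℝ × ℝ) :
    ∃ w₁₁ : ℝ × ℝ,
      w₁₁.1 = w₀₀.1 + w₁₀.1 - w₀₁.1 + 4 * h * R₁ (cellData h c w₀₀ w₁₀ w₀₁ w₁₁) ∧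
      w₁₁.2 = w₀₀.2 + w₀₁.2 - w₁₀.2 + 4 * h * R₂ (cellData h c w₀₀ w₁₀ w₀₁ w₁₁) := by
  let Φ : ℝ × ℝ → ℝ × ℝ := fun w =>
    (w₀₀.1 + w₁₀.1 - w₀₁.1 + 4 * h * R₁ (cellData h c w₀₀ w₁₀ w₀₁ w),
      w₀₀.2 + w₀₁.2 - w₁₀.2 + 4 * h * R₂ (cellData h c w₀₀ w₁₀ w₀₁ w))
  have key : ∀ {R : QuadData × ℝ → ℝ}, LipschitzWith Λ R → ∀ (k : ℝ) (v w : ℝ × ℝ),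
      dist (k + 4 * h * R (cellData h c w₀₀ w₁₀ w₀₁ v)) (k + 4 * h * R (cellData h c w₀₀ w₁₀ w₀₁ w))
        ≤ h * Λ * dist v w := by
    intro R hR k v w
    have h1 := (hR.dist_le_mul (cellData h c w₀₀ w₁₀ w₀₁ v) (cellData h c w₀₀ w₁₀ w₀₁ w)).trans
      (mul_le_mul_of_nonneg_left (dist_cellData_le hh hh1 c w₀₀ w₁₀ w₀₁ v w) Λ.2)
    rw [dist_add_left, Real.dist_eq, ← mul_sub, abs_mul, abs_of_nonneg (by positivity : 0 ≤ 4 * h),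
      ← Real.dist_eq]
    calc _ ≤ 4 * h * (Λ * (1 / 4 * dist v w)) := by gcongr
      _ = _ := by ring
  -- The factor `4 h` of the equation and the factor 1/4 of `dist_cellData_le` combine to the ratio
  -- `h * Λ`.
  have hΦ : ContractingWith (Real.toNNReal (h * Λ)) Φ := by
    refine ⟨by rw [← NNReal.coe_lt_coe, Real.coe_toNNReal _ (by positivity)]; exact_mod_cast hΛ,
      LipschitzWith.of_dist_le_mul fun v w => ?_⟩
    rw [Real.coe_toNNReal _ (by positivity), Prod.dist_eq]
    exact max_le (key hR₁ _ v w) (key hR₂ _ v w)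
  have hfix := hΦ.fixedPoint_isFixedPt
  exact ⟨hΦ.fixedPoint, (congrArg Prod.fst hfix).symm, (congrArg Prod.snd hfix).symm⟩

/-- Solvability of a Goursat problem on the lattice quadrant. -/
theorem exists_goursat {E : Type} [Zero E] {P : ℕ → ℕ → E → E → E → E → Prop}
    (hP : ∀ i j a b c, ∃ d, P i j a b c d) :
    ∃ w : ℕ → ℕ → E, (∀ i, w i 0 = 0) ∧ (∀ j, w 0 j = 0) ∧
      ∀ i j, P i j (w i j) (w (i + 1) j) (w i (j + 1)) (w (i + 1) (j + 1)) := by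
  choose g hg using hP
  let row : ℕ → ℕ → E := fun j => Nat.rec (fun _ => 0)
    (fun j r i => Nat.rec 0 (fun i x => g i j (r i) (r (i + 1)) x) i) j
  exact ⟨fun i j => row j i, fun _ => rfl, fun j => by cases j <;> rfl, fun i j => hg i j _ _ _⟩

/-- The centre of a cell of the square lattice with mesh `2 h` and corner `p`. -/
noncomputable def cellCenter (p : ℝ × ℝ) (h : ℝ) (i j : ℕ) : ℝ × ℝ :=
  (p.1 + (2 * i + 1) * h, p.2 + (2 * j + 1) * h)

theorem dist_squareData_le {h : ℝ} (hh : 0 ≤ h) (p : ℝ × ℝ) (i j : ℕ) :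
    dist (squareData h (cellCenter p h (i + 1) j)) (squareData h (cellCenter p h i j)) ≤ 2 * h ∧
    dist (squareData h (cellCenter p h i (j + 1))) (squareData h (cellCenter p h i j)) ≤ 2 * h := by
  have e : ∀ x k : ℝ, |x + (2 * (k + 1) + 1) * h - (x + (2 * k + 1) * h)| ≤ 2 * h := by
    intro x k
    rw [show x + (2 * (k + 1) + 1) * h - (x + (2 * k + 1) * h) = 2 * h by ring,
      abs_of_nonneg (by positivity)]
  constructor <;>
  · rw [dist_eq_norm]
    simp only [squareData, cellCenter, Prod.mk_sub_mk, Prod.norm_def, sub_self, norm_zero,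
      sup_le_iff, Real.norm_eq_abs, Nat.cast_add, Nat.cast_one, e, true_and]
    simp [hh]

/-- Subtracting two consecutive equations cancels the middle difference `y` and leaves `4 h (R q - R
q')`. Since `q` and `q'` are near the neighbouring squares `r` and `r'`, this is of second order in
`h` when `e` and `e'` are O(h). -/
theorem abs_le_of_alternating {R : QuadData × ℝ → ℝ} {Λ : NNReal} (hR : LipschitzWith Λ R)
    {h e e' b x y z : ℝ} {q q' r r' : QuadData × ℝ} (hh : 0 ≤ h) (hx : x + y = 4 * h * R q)
    (hy : y + z = 4 * h * R q') (hz : |z| ≤ b) (hq : dist q r ≤ e) (hq' : dist q' r' ≤ e')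
    (hr : dist r r' ≤ 2 * h) : |x| ≤ b + 4 * h * (Λ * (2 * h + e + e')) := by
  have h1 : dist q q' ≤ 2 * h + e + e' := by
    have := dist_triangle4 q r r' q'
    rw [dist_comm r' q'] at this
    linarith
  have h2 : |R q - R q'| ≤ Λ * (2 * h + e + e') :=
    (hR.dist_le_mul q q').trans (mul_le_mul_of_nonneg_left h1 Λ.2)
  have h3 : x = z + 4 * h * (R q - R q') := by linear_combination hx - hy
  calc |x| ≤ |z| + |4 * h * (R q - R q')| := by rw [h3]; exact abs_add_le _ _
    _ = |z| + 4 * h * |R q - R q'| := by rw [abs_mul, abs_of_nonneg (by positivity : 0 ≤ 4 * h)]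
    _ ≤ _ := by gcongr

/-- Next to an axis there is no earlier cell to subtract, but the preceding difference is zero, so a
plain bound of order `h` suffices. -/
theorem abs_le_of_boundary {R : QuadData × ℝ → ℝ} {Λ : NNReal} (hR : LipschitzWith Λ R)
    {h e b x : ℝ} {q r : QuadData × ℝ} (hh : 0 ≤ h) (hx : x = 4 * h * R q)
    (hq : dist q r ≤ e) (hr : |R r| ≤ b) : |x| ≤ 4 * h * (b + Λ * e) := by
  have h2 : |R q - R r| ≤ Λ * e :=
    (hR.dist_le_mul q r).trans (mul_le_mul_of_nonneg_left hq Λ.2)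
  have h3 : |R q| ≤ b + Λ * e := by
    have := abs_add_le (R r) (R q - R r)
    rw [add_sub_cancel] at this
    linarith
  rw [hx, abs_mul, abs_of_nonneg (by positivity : 0 ≤ 4 * h)]
  gcongr

/-- The arithmetic that closes the growth estimate. -/
theorem goursat_closing {h Λ l g G m : ℝ} (hh : 0 < h) (hΛ : 0 ≤ Λ) (hl : 96 * Λ + 1 ≤ l)
    (hlh : l * h ≤ 1) (hg1 : 1 ≤ g) (hGg : G = g + l * h * g)
    (hmle : m ≤ h * g + 4 * h * (Λ * (2 * h + (2 * (h * G) + 2 * m) + 2 * (h * G)))) :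
    m ≤ h * G := by
  have e0 : 96 * (h * Λ) ≤ 1 := by
    have := mul_le_mul_of_nonneg_right hl hh.le
    linarith
  have hg0 : 0 ≤ g := by linarith
  have hhΛ : 0 ≤ h * Λ := mul_nonneg hh.le hΛ
  have hG2 : G ≤ 2 * g := by
    have := mul_le_mul_of_nonneg_right hlh hg0
    linarith
  have e2 : h * (h * Λ * G) ≤ h * (2 * (h * Λ * g)) := by
    refine mul_le_mul_of_nonneg_left ?_ hh.le
    have := mul_le_mul_of_nonneg_left hG2 hhΛ
    linarith
  have e3 : h * (h * Λ) ≤ h * (h * Λ * g) :=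
    mul_le_mul_of_nonneg_left (le_mul_of_one_le_right hhΛ hg1) hh.le
  -- The unknown `m` is absorbed on the left; what remains is a comparison of `1 + 40 h Λ` with `(1
  -- + l h) (1 - 8 h Λ)`.
  have e4 : m * (1 - 8 * (h * Λ)) ≤ h * (g + 40 * (h * Λ * g)) := by linarith
  have e5 : h * (g + 40 * (h * Λ * g)) ≤ h * G * (1 - 8 * (h * Λ)) := by
    rw [mul_assoc h G]
    refine mul_le_mul_of_nonneg_left ?_ hh.le
    rw [hGg]
    have e6 : 0 ≤ h * g * (l - 48 * Λ - 8 * (Λ * (l * h))) := by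
      refine mul_nonneg (mul_nonneg hh.le hg0) ?_
      have := mul_le_mul_of_nonneg_left hlh hΛ
      linarith
    linarith
  exact le_of_mul_le_mul_right (e4.trans e5) (by linarith)

/-- A solution of the lattice Goursat problem vanishing on the axes grows at most exponentially,
and its differences transversal to the alternating directions are of the order of the mesh. -/
theorem goursat_bound {R₁ R₂ : QuadData × ℝ → ℝ} {Λ : NNReal} (hR₁ : LipschitzWith Λ R₁)
    (hR₂ : LipschitzWith Λ R₂) {B K l h : ℝ}
    (hB₁ : ∀ c : ℝ × ℝ, ‖c‖ ≤ 31 → |R₁ (squareData h c)| ≤ B)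
    (hB₂ : ∀ c : ℝ × ℝ, ‖c‖ ≤ 31 → |R₂ (squareData h c)| ≤ B)
    (hK1 : 1 ≤ K) (hKB : 4 * B ≤ K) (hl : 96 * Λ + 1 ≤ l) (hh : 0 < h) (hlh : l * h ≤ 1)
    {p : ℝ × ℝ} (hp : ‖p‖ ≤ 10) {w : ℕ → ℕ → ℝ × ℝ} (hw1 : ∀ i, w i 0 = 0) (hw2 : ∀ j, w 0 j = 0)
    (heq₁ : ∀ i j, (w (i + 1) (j + 1)).1 = (w i j).1 + (w (i + 1) j).1 - (w i (j + 1)).1 +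
      4 * h * R₁ (cellData h (cellCenter p h i j) (w i j) (w (i + 1) j) (w i (j + 1)) (w (i + 1) (j + 1))))
    (heq₂ : ∀ i j, (w (i + 1) (j + 1)).2 = (w i j).2 + (w i (j + 1)).2 - (w (i + 1) j).2 +
      4 * h * R₂ (cellData h (cellCenter p h i j) (w i j) (w (i + 1) j) (w i (j + 1)) (w (i + 1) (j + 1))))
    (s : ℕ) : s * h ≤ 10 → ∀ i j, i + j ≤ s →
      ‖w i j‖ ≤ K * (1 + l * h) ^ s ∧
      |(w i (j + 1)).1 - (w i j).1| ≤ h * (K * (1 + l * h) ^ s) ∧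
      |(w (i + 1) j).2 - (w i j).2| ≤ h * (K * (1 + l * h) ^ s) := by
  have hΛ : (0 : ℝ) ≤ Λ := Λ.2
  have hl0 : 0 ≤ l := by linarith
  have hh1 : h ≤ 1 := by nlinarith
  have hg1 : ∀ n : ℕ, 1 ≤ K * (1 + l * h) ^ n := fun n =>
    one_le_mul_of_one_le_of_one_le hK1 (one_le_pow₀ (by nlinarith))
  induction s with
  | zero =>
    intro _ i j hij
    obtain ⟨rfl, rfl⟩ : i = 0 ∧ j = 0 := by omega
    have := hg1 0
    simp only [hw1, hw2, norm_zero, Prod.fst_zero, Prod.snd_zero, sub_self, abs_zero, and_self]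
    exact ⟨by linarith, by positivity⟩
  | succ s ih =>
    intro hs
    have hs' : s * h ≤ 10 := by push_cast at hs; linarith
    have ih := ih hs'
    set g := K * (1 + l * h) ^ s with hg
    set G := K * (1 + l * h) ^ (s + 1) with hG
    have hGg : G = g + l * h * g := by rw [hG, hg, pow_succ]; ring
    have hg1' : 1 ≤ g := hg1 s
    have hgG : g + h * g ≤ G := by
      rw [hGg]; nlinarith [mul_nonneg (mul_nonneg hh.le (by linarith : 0 ≤ g)) (by linarith : 0 ≤ l - 1)]
    have hgG' : g ≤ G := by nlinarith
    have hG2 : G ≤ 2 * g := by rw [hGg]; nlinarith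
    -- the values on the next level
    have hval : ∀ i j, i + j ≤ s + 1 → ‖w i j‖ ≤ G := by
      intro i j hij
      rw [Prod.norm_def]
      refine max_le ?_ ?_ <;> rw [Real.norm_eq_abs]
      · rcases j with _ | j
        · rw [hw1]; simp; linarith
        · obtain ⟨h1, h2, -⟩ := ih i j (by omega)
          have h3 := (norm_fst_le _).trans h1
          rw [Real.norm_eq_abs] at h3
          have := abs_add_le ((w i (j + 1)).1 - (w i j).1) (w i j).1
          rw [sub_add_cancel] at this
          linarith
      · rcases i with _ | i
        · rw [hw2]; simp; linarith
        · obtain ⟨h1, -, h2⟩ := ih i j (by omega)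
          have h3 := (norm_snd_le _).trans h1
          rw [Real.norm_eq_abs] at h3
          have := abs_add_le ((w (i + 1) j).2 - (w i j).2) (w i j).2
          rw [sub_add_cancel] at this
          linarith
    -- the differences on the next level
    have hcen : ∀ i j, i + j ≤ s → ‖cellCenter p h i j‖ ≤ 31 := by
      intro i j hij
      have hi : (i : ℝ) + j ≤ s := by exact_mod_cast hij
      have hi0 : (0 : ℝ) ≤ i := i.cast_nonneg
      have hj0 : (0 : ℝ) ≤ j := j.cast_nonneg
      have h1 := (norm_fst_le _).trans hp
      have h2 := (norm_snd_le _).trans hp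
      have h3 : (i : ℝ) * h ≤ 10 := by nlinarith
      have h4 : (j : ℝ) * h ≤ 10 := by nlinarith
      rw [Real.norm_eq_abs, abs_le] at h1 h2
      simp only [cellCenter, Prod.norm_def, sup_le_iff, Real.norm_eq_abs, abs_le]
      have := mul_nonneg hi0 hh.le
      have := mul_nonneg hj0 hh.le
      refine ⟨⟨?_, ?_⟩, ?_, ?_⟩ <;> nlinarith
    have hdif : ∀ i j, i + j = s →
        |(w (i + 1) (j + 1)).1 - (w (i + 1) j).1| ≤ h * G ∧
        |(w (i + 1) (j + 1)).2 - (w i (j + 1)).2| ≤ h * G := by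
      intro i j hij
      set x := (w (i + 1) (j + 1)).1 - (w (i + 1) j).1 with hx
      set y := (w (i + 1) (j + 1)).2 - (w i (j + 1)).2 with hy
      -- The new differences also occur inside the cell data on the right-hand side, because the
      -- fourth vertex is defined implicitly. They are bounded jointly by `m`, and `goursat_closing`
      -- then removes `m` from the right.
      set m := max |x| |y| with hm
      have hxm : |x| ≤ m := le_max_left _ _
      have hym : |y| ≤ m := le_max_right _ _
      have hm0 : 0 ≤ m := (abs_nonneg x).trans hxm
      have h11 : ‖w (i + 1) (j + 1)‖ ≤ G + m := by
        rw [Prod.norm_def]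
        refine max_le ?_ ?_ <;> rw [Real.norm_eq_abs]
        · have h3 := (norm_fst_le _).trans (hval (i + 1) j (by omega))
          have := abs_add_le x (w (i + 1) j).1
          rw [Real.norm_eq_abs] at h3
          rw [hx, sub_add_cancel, ← hx] at this
          linarith
        · have h3 := (norm_snd_le _).trans (hval i (j + 1) (by omega))
          have := abs_add_le y (w i (j + 1)).2
          rw [Real.norm_eq_abs] at h3
          rw [hy, sub_add_cancel, ← hy] at this
          linarith
      have hge : h * g ≤ h * g + m := by linarith
      have hmm : h * g ≤ h * G := mul_le_mul_of_nonneg_left hgG' hh.le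
      have hhg : 0 ≤ h * g := mul_nonneg hh.le (by linarith)
      have hhm : h * m ≤ m := mul_le_of_le_one_left hm0 hh1
      have hcell := dist_cellData_squareData_le (c := cellCenter p h i j) hh.le hh1
        ((hval i j (by omega)).trans (by linarith : G ≤ G + m))
        ((hval (i + 1) j (by omega)).trans (by linarith : G ≤ G + m))
        ((hval i (j + 1) (by omega)).trans (by linarith : G ≤ G + m)) h11
        ((ih i j (by omega)).2.1.trans hge) (by linarith : |x| ≤ h * g + m)
        ((ih i j (by omega)).2.2.trans hge) (by linarith : |y| ≤ h * g + m)
      have hcell' := hcell.trans (by linarith : h * (G + m) + (h * g + m) ≤ 2 * (h * G) + 2 * m)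
      have hgoal : m ≤ h * g + 4 * h * (Λ * (2 * h + (2 * (h * G) + 2 * m) + 2 * (h * G))) →
          m ≤ h * G := fun hmle =>
        goursat_closing hh hΛ hl hlh hg1' hGg hmle
      have hbd : 4 * h * (B + Λ * (2 * (h * G) + 2 * m)) ≤
          h * g + 4 * h * (Λ * (2 * h + (2 * (h * G) + 2 * m) + 2 * (h * G))) := by
        have e1 : 4 * B ≤ g := hKB.trans (le_mul_of_one_le_right (by linarith) (one_le_pow₀ (by nlinarith)))
        have e2 : 0 ≤ h * Λ * (2 * h + 2 * (h * G)) := by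
          have : 0 ≤ h * G := by linarith
          positivity
        have e3 := mul_le_mul_of_nonneg_left e1 hh.le
        linarith
      have hmle : m ≤ h * g + 4 * h * (Λ * (2 * h + (2 * (h * G) + 2 * m) + 2 * (h * G))) := by
        have hprev : ∀ i j, i + j + 1 = s → dist (cellData h (cellCenter p h i j) (w i j)
            (w (i + 1) j) (w i (j + 1)) (w (i + 1) (j + 1))) (squareData h (cellCenter p h i j))
              ≤ 2 * (h * G) := by
          intro i j hij
          refine (dist_cellData_squareData_le (δ := h * G) hh.le hh1
            (hval i j (by omega)) (hval (i + 1) j (by omega)) (hval i (j + 1) (by omega))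
            (hval (i + 1) (j + 1) (by omega)) ((ih i j (by omega)).2.1.trans hmm)
            ((ih (i + 1) j (by omega)).2.1.trans hmm) ((ih i j (by omega)).2.2.trans hmm)
            ((ih i (j + 1) (by omega)).2.2.trans hmm)).trans (by linarith)
        refine max_le ?_ ?_
        · rcases i with _ | i
          · refine (abs_le_of_boundary hR₁ hh.le ?_ hcell' (hB₁ _ (hcen _ _ hij.le))).trans hbd
            have := heq₁ 0 j
            simp only [hw2, Prod.fst_zero] at this ⊢
            rw [hx, this]; ring
          · refine abs_le_of_alternating hR₁ hh.le
              (y := (w (i + 1) (j + 1)).1 - (w (i + 1) j).1) (z := (w i (j + 1)).1 - (w i j).1)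
              ?_ ?_ (ih i j (by omega)).2.1 hcell' (hprev i j (by omega)) (dist_squareData_le hh.le p i j).1
            · rw [hx]; linarith [heq₁ (i + 1) j]
            · linarith [heq₁ i j]
        · rcases j with _ | j
          · refine (abs_le_of_boundary hR₂ hh.le ?_ hcell' (hB₂ _ (hcen _ _ hij.le))).trans hbd
            have := heq₂ i 0
            simp only [hw1, Prod.snd_zero] at this ⊢
            rw [hy, this]; ring
          · refine abs_le_of_alternating hR₂ hh.le
              (y := (w (i + 1) (j + 1)).2 - (w i (j + 1)).2) (z := (w (i + 1) j).2 - (w i j).2)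
              ?_ ?_ (ih i j (by omega)).2.2 hcell' (hprev i j (by omega)) (dist_squareData_le hh.le p i j).2
            · rw [hy]; linarith [heq₂ i (j + 1)]
            · linarith [heq₂ i j]
      have := hgoal hmle
      exact ⟨hxm.trans this, hym.trans this⟩
    have hmm : h * g ≤ h * G := by gcongr
    have hhG : 0 ≤ h * G := by nlinarith
    intro i j hij
    refine ⟨hval i j hij, ?_, ?_⟩
    · rcases Nat.lt_or_ge (i + j) (s + 1) with hlt | hge
      · exact (ih i j (by omega)).2.1.trans hmm
      · rcases i with _ | i
        · simpa [hw2] using hhG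
        · exact (hdif i j (by omega)).1
    · rcases Nat.lt_or_ge (i + j) (s + 1) with hlt | hge
      · exact (ih i j (by omega)).2.2.trans hmm
      · rcases j with _ | j
        · simpa [hw1] using hhG
        · exact (hdif i j (by omega)).2

/-- Bounded solutions of the lattice Goursat problem, uniformly in the mesh. -/
theorem exists_lattice_displacement {R₁ R₂ : QuadData × ℝ → ℝ} {Λ : NNReal}
    (hR₁ : LipschitzWith Λ R₁) (hR₂ : LipschitzWith Λ R₂) :
    ∃ K : ℝ, 1 ≤ K ∧ ∃ h₀ : ℝ, 0 < h₀ ∧ ∀ h : ℝ, 0 < h → h < h₀ → ∀ p : ℝ × ℝ, ‖p‖ ≤ 10 →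
      ∃ w : ℕ → ℕ → ℝ × ℝ, ∀ i j : ℕ, (i + j : ℕ) * h ≤ 10 →
        ‖w i j‖ ≤ K ∧
        (w (i + 1) (j + 1)).1 + (w i (j + 1)).1 - (w (i + 1) j).1 - (w i j).1 =
          4 * h * R₁ (cellData h (cellCenter p h i j) (w i j) (w (i + 1) j) (w i (j + 1))
            (w (i + 1) (j + 1))) ∧
        (w (i + 1) (j + 1)).2 + (w (i + 1) j).2 - (w i (j + 1)).2 - (w i j).2 =
          4 * h * R₂ (cellData h (cellCenter p h i j) (w i j) (w (i + 1) j) (w i (j + 1))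
            (w (i + 1) (j + 1))) ∧
        |(w i (j + 1)).1 - (w i j).1| ≤ h * K ∧ |(w (i + 1) j).2 - (w i j).2| ≤ h * K := by
  -- `l` is the growth rate required by `goursat_closing`; in `B`, 31 bounds the distance from 0 to
  -- the model squares that occur.
  set l : ℝ := 96 * Λ + 1 with hl
  set B : ℝ := max |R₁ 0| |R₂ 0| + Λ * 31 with hB
  have hΛ : (0 : ℝ) ≤ Λ := Λ.2
  have hB0 : 0 ≤ B := add_nonneg ((abs_nonneg _).trans (le_max_left _ _)) (by positivity)
  have hl1 : 1 ≤ l := by linarith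
  have hbase : ∀ {R : QuadData × ℝ → ℝ}, LipschitzWith Λ R → |R 0| ≤ max |R₁ 0| |R₂ 0| →
      ∀ h : ℝ, 0 < h → h ≤ 1 → ∀ c : ℝ × ℝ, ‖c‖ ≤ 31 → |R (squareData h c)| ≤ B := by
    intro R hR hR0 h hh hh1 c hc
    have h1 : dist (squareData h c) 0 ≤ 31 := by
      rw [dist_zero_right]
      simp only [squareData, Prod.norm_mk, sup_le_iff, hc, norm_one, norm_zero, Real.norm_eq_abs,
        abs_of_pos hh]
      norm_num
      linarith
    have h2 := (hR.dist_le_mul (squareData h c) 0).trans (mul_le_mul_of_nonneg_left h1 hΛ)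
    rw [Real.dist_eq] at h2
    have := abs_add_le (R 0) (R (squareData h c) - R 0)
    rw [add_sub_cancel] at this
    linarith
  -- At most `10 / h` diagonals occur, and `(1 + l h) ^ (10 / h)` is at most `exp (10 l)`.
  refine ⟨(1 + 4 * B) * Real.exp (l * 10), ?_, 1 / l, by positivity, fun h hh hh0 p hp => ?_⟩
  · exact one_le_mul_of_one_le_of_one_le (by linarith) (Real.one_le_exp (by positivity))
  · have hlh : l * h ≤ 1 := by
      rw [lt_div_iff₀ (by positivity)] at hh0; linarith
    have hh1 : h ≤ 1 := by nlinarith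
    obtain ⟨w, hw1, hw2, hw⟩ := exists_goursat (fun i j =>
      exists_fourth_vertex hR₁ hR₂ hh.le hh1 (by nlinarith) (cellCenter p h i j))
    refine ⟨w, fun i j hij => ?_⟩
    obtain ⟨h1, h2, h3⟩ := goursat_bound hR₁ hR₂ (hbase hR₁ (le_max_left _ _) h hh hh1)
      (hbase hR₂ (le_max_right _ _) h hh hh1) (by linarith : 1 ≤ 1 + 4 * B) (by linarith) le_rfl hh hlh
      hp hw1 hw2 (fun i j => (hw i j).1) (fun i j => (hw i j).2) (i + j) hij i j le_rfl
    have hgr : (1 + 4 * B) * (1 + l * h) ^ (i + j) ≤ (1 + 4 * B) * Real.exp (l * 10) := by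
      refine mul_le_mul_of_nonneg_left ?_ (by linarith)
      calc (1 + l * h) ^ (i + j) ≤ Real.exp (l * h) ^ (i + j) := by
            gcongr
            linarith [Real.add_one_le_exp (l * h)]
        _ = Real.exp (l * ((i + j : ℕ) * h)) := by rw [← Real.exp_nat_mul]; congr 1; ring
        _ ≤ _ := by gcongr
    have hgr' := mul_le_mul_of_nonneg_left hgr hh.le
    exact ⟨h1.trans hgr, by linarith [(hw i j).1], by linarith [(hw i j).2], h2.trans hgr', h3.trans hgr'⟩

/-! ### Smooth difference quotients on parameter quadrilaterals. -/

theorem contDiff_dot {X : Type} [NormedAddCommGroup X] [NormedSpace ℝ X] {a b : X → E3}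
    (ha : ContDiff ℝ ∞ a) (hb : ContDiff ℝ ∞ b) : ContDiff ℝ ∞ fun x => dot (a x) (b x) := by
  simp_rw [← inner_eq_dot]
  exact ha.inner ℝ hb

theorem contDiff_triple {X : Type} [NormedAddCommGroup X] [NormedSpace ℝ X] {a b c : X → E3}
    (ha : ContDiff ℝ ∞ a) (hb : ContDiff ℝ ∞ b) (hc : ContDiff ℝ ∞ c) :
    ContDiff ℝ ∞ fun x => triple (a x) (b x) (c x) := by
  have ha' := contDiff_euclidean.1 ha
  have hb' := contDiff_euclidean.1 hb
  have hc' := contDiff_euclidean.1 hc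
  exact (((ha' 0).mul (((hb' 1).mul (hc' 2)).sub ((hb' 2).mul (hc' 1)))).add
    ((ha' 1).mul (((hb' 2).mul (hc' 0)).sub ((hb' 0).mul (hc' 2))))).add
    ((ha' 2).mul (((hb' 0).mul (hc' 1)).sub ((hb' 1).mul (hc' 0))))

theorem contDiff_gram {X : Type} [NormedAddCommGroup X] [NormedSpace ℝ X] {a b : X → E3}
    (ha : ContDiff ℝ ∞ a) (hb : ContDiff ℝ ∞ b) : ContDiff ℝ ∞ fun x => gram (a x) (b x) :=
  ((contDiff_dot ha ha).mul (contDiff_dot hb hb)).sub ((contDiff_dot ha hb).pow 2)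

theorem contDiff_circDefect {X : Type} [NormedAddCommGroup X] [NormedSpace ℝ X] {a b c : X → E3}
    {h : X → ℝ} (hh : ContDiff ℝ ∞ h)
    (ha : ContDiff ℝ ∞ a) (hb : ContDiff ℝ ∞ b) (hc : ContDiff ℝ ∞ c) :
    ContDiff ℝ ∞ fun x => circDefect (h x) (a x) (b x) (c x) :=
  ((contDiff_dot ha hb).mul (contDiff_gram ha hb)).sub ((hh.pow 2).mul
    ((((contDiff_dot ha ha).add (contDiff_dot hb hb)).mul
      ((contDiff_dot ha hc).mul (contDiff_dot hb hc))).sub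
      ((contDiff_dot ha hb).mul (((contDiff_dot ha hc).pow 2).add ((contDiff_dot hb hc).pow 2)))))

/-- The vertex `c + s h U + t h V + s t h ^ 2 T` of a parameter quadrilateral. -/
def quadVertex (s t : ℝ) (q : QuadData × ℝ) : ℝ × ℝ :=
  q.1.1 + (s * q.2) • q.1.2.1 + (t * q.2) • q.1.2.2.1 + (s * t * q.2 ^ 2) • q.1.2.2.2

theorem contDiff_quadVertex (s t : ℝ) : ContDiff ℝ ∞ (quadVertex s t) := by
  unfold quadVertex
  fun_prop

/-- The source of all evenness in `h`: changing its sign only exchanges opposite vertices. -/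
theorem quadVertex_neg (s t : ℝ) (x : QuadData) (h : ℝ) :
    quadVertex s t (x, -h) = quadVertex (-s) (-t) (x, h) := by
  simp [quadVertex]

theorem quadVertex_zero (s t : ℝ) (x : QuadData) : quadVertex s t (x, 0) = x.1 := by
  simp [quadVertex]

theorem hasDerivAt_quadVertex (s t : ℝ) (x : QuadData) (h : ℝ) :
    HasDerivAt (fun h => quadVertex s t (x, h))
      (s • x.2.1 + t • x.2.2.1 + (2 * s * t * h) • x.2.2.2) h := by
  have h1 := ((((hasDerivAt_id h).const_mul s).smul_const x.2.1).const_add x.1).add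
    (((hasDerivAt_id h).const_mul t).smul_const x.2.2.1)
  have h2 := h1.add ((((hasDerivAt_id h).pow 2).const_mul (s * t)).smul_const x.2.2.2)
  refine h2.congr_deriv ?_
  simp only [id, Nat.cast_ofNat]
  module

variable {g : ℝ × ℝ → E3}

theorem hasDerivAt_comp_quadVertex (hg : ContDiff ℝ ∞ g) (s t : ℝ) (x : QuadData) (h : ℝ) :
    HasDerivAt (fun h => g (quadVertex s t (x, h))) (fderiv ℝ g (quadVertex s t (x, h))
      (s • x.2.1 + t • x.2.2.1 + (2 * s * t * h) • x.2.2.2)) h :=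
  ((hg.differentiable (by simp) _).hasFDerivAt).comp_hasDerivAt h (hasDerivAt_quadVertex s t x h)

/-- The mean difference quotient of `g` along one pair of opposite edges of a quadrilateral
extends smoothly and evenly to mesh zero. -/
theorem exists_smooth_bimedian (hg : ContDiff ℝ ∞ g) :
    ∃ D : QuadData × ℝ → E3, ContDiff ℝ ∞ D ∧ (∀ x h, D (x, -h) = D (x, h)) ∧
      (∀ x, D (x, 0) = fderiv ℝ g x.1 x.2.1) ∧
      ∀ q, g (quadVertex 1 1 q) + g (quadVertex 1 (-1) q) - g (quadVertex (-1) 1 q)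
        - g (quadVertex (-1) (-1) q) = (4 * q.2) • D q := by
  have hgq := fun s t => hg.comp (contDiff_quadVertex s t)
  obtain ⟨N, hN, hGN, hder⟩ := exists_smooth_quotient (((hgq 1 1).add (hgq 1 (-1))).sub
    (hgq (-1) 1) |>.sub (hgq (-1) (-1))) (by intro x; simp [quadVertex_zero])
  simp only [Function.comp_apply] at hGN hder
  refine ⟨fun q => (1 / 4 : ℝ) • N q, hN.const_smul _, fun x h => ?_, fun x => ?_, fun q => ?_⟩
  · rcases eq_or_ne h 0 with rfl | hh
    · simp
    · have h1 := hGN x h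
      have h2 := hGN x (-h)
      simp only [quadVertex_neg, neg_neg] at h2
      have h3 : h • N (x, -h) = h • N (x, h) := by
        rw [← h1, ← neg_inj, ← neg_smul, ← h2]; abel
      exact congrArg _ (smul_right_injective E3 hh h3)
  · have hd := hasDerivAt_comp_quadVertex hg
    have h1 := (hder x).unique ((((hd 1 1 x 0).add (hd 1 (-1) x 0)).sub (hd (-1) 1 x 0)).sub
      (hd (-1) (-1) x 0))
    simp only [quadVertex_zero] at h1
    change (1 / 4 : ℝ) • N (x, 0) = _
    rw [h1, ← map_add, ← map_sub, ← map_sub, ← map_smul]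
    congr 1
    module
  · rw [show q = (q.1, q.2) from rfl, hGN]
    module

/-- The mixed second difference quotient of `g` on a quadrilateral extends smoothly and evenly to
mesh zero. -/
theorem exists_smooth_mixed_quotient (hg : ContDiff ℝ ∞ g) :
    ∃ D : QuadData × ℝ → E3, ContDiff ℝ ∞ D ∧ (∀ x h, D (x, -h) = D (x, h)) ∧
      (∀ x, D (x, 0) = (1 / 2 : ℝ) • (fderiv ℝ (fderiv ℝ g) x.1 x.2.1 x.2.2.1
        + fderiv ℝ (fderiv ℝ g) x.1 x.2.2.1 x.2.1) + fderiv ℝ g x.1 x.2.2.2) ∧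
      ∀ q, g (quadVertex 1 1 q) - g (quadVertex 1 (-1) q) - g (quadVertex (-1) 1 q)
        + g (quadVertex (-1) (-1) q) = (4 * q.2 ^ 2) • D q := by
  have hgq := fun s t => hg.comp (contDiff_quadVertex s t)
  have hd := hasDerivAt_comp_quadVertex hg
  obtain ⟨A, hA, hGA, hder⟩ := exists_smooth_quotient (((hgq 1 1).sub (hgq 1 (-1))).sub
    (hgq (-1) 1) |>.add (hgq (-1) (-1))) (by intro x; simp [quadVertex_zero])
  simp only [Function.comp_apply] at hGA hder
  have hdM := fun x h => (((hd 1 1 x h).sub (hd 1 (-1) x h)).sub (hd (-1) 1 x h)).add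
    (hd (-1) (-1) x h)
  have hA0 : ∀ x, A (x, 0) = 0 := by
    intro x
    have h1 := (hder x).unique (hdM x 0)
    simp only [quadVertex_zero] at h1
    rw [h1, ← map_sub, ← map_sub, ← map_add]
    convert map_zero (fderiv ℝ g x.1) using 2
    module
  obtain ⟨N, hN, hAN, -⟩ := exists_smooth_quotient hA hA0
  have hGN : ∀ x h, g (quadVertex 1 1 (x, h)) - g (quadVertex 1 (-1) (x, h))
      - g (quadVertex (-1) 1 (x, h)) + g (quadVertex (-1) (-1) (x, h)) = h ^ 2 • N (x, h) := by
    intro x h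
    rw [hGA, hAN, smul_smul, pow_two]
  refine ⟨fun q => (1 / 4 : ℝ) • N q, hN.const_smul _, fun x h => ?_, fun x => ?_, fun q => ?_⟩
  · rcases eq_or_ne h 0 with rfl | hh
    · simp
    · have h1 := hGN x h
      have h2 := hGN x (-h)
      simp only [quadVertex_neg, neg_neg] at h2
      have h3 : h ^ 2 • N (x, -h) = h ^ 2 • N (x, h) := by
        rw [← h1, ← neg_sq, ← h2]; abel
      exact congrArg _ (smul_right_injective E3 (pow_ne_zero 2 hh) h3)
  -- The mixed difference is `h ^ 2 • φ h`, so `2 • φ 0` is its second derivative at 0. The first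
  -- derivative is computed for all `h` in two ways, and both expressions are differentiated once
  -- more at 0.
  · let φ : ℝ → E3 := fun h => N (x, h)
    have hφ : ContDiff ℝ ∞ φ := hN.comp (by fun_prop)
    have hφ' : ContDiff ℝ ∞ (deriv φ) := ((contDiff_infty_iff_deriv).1 hφ).2
    have hφd : ∀ h, HasDerivAt φ (deriv φ h) h := fun h =>
      (hφ.differentiable (by simp) h).hasDerivAt
    have hdF : ∀ h, HasDerivAt (fun h => h ^ 2 • φ h) (h ^ 2 • deriv φ h + (2 * h) • φ h) h := by
      intro h
      exact ((hasDerivAt_pow 2 h).smul (hφd h)).congr_deriv (by simp)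
    have hdd : HasDerivAt (fun h : ℝ => h ^ 2 • deriv φ h + (2 * h) • φ h) ((2 : ℝ) • φ 0) 0 := by
      have h1 := (hasDerivAt_pow 2 (0 : ℝ)).smul (hφ'.differentiable (by simp) 0).hasDerivAt
      have h2 := ((hasDerivAt_id (0 : ℝ)).const_mul 2).smul (hφd 0)
      exact (h1.add h2).congr_deriv (by simp)
    have hm : ∀ s t : ℝ, HasDerivAt (fun h => fderiv ℝ g (quadVertex s t (x, h))
        (s • x.2.1 + t • x.2.2.1 + (2 * s * t * h) • x.2.2.2))
        (fderiv ℝ (fderiv ℝ g) x.1 (s • x.2.1 + t • x.2.2.1) (s • x.2.1 + t • x.2.2.1)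
          + fderiv ℝ g x.1 ((2 * s * t) • x.2.2.2)) 0 := by
      intro s t
      have hdg : ContDiff ℝ ∞ (fderiv ℝ g) := hg.fderiv_right (by simp)
      have h1 : HasDerivAt (fun h => fderiv ℝ g (quadVertex s t (x, h))) _ 0 :=
        ((hdg.differentiable (by simp) _).hasFDerivAt).comp_hasDerivAt 0
          (hasDerivAt_quadVertex s t x 0)
      have h2 : HasDerivAt (fun h : ℝ => s • x.2.1 + t • x.2.2.1 + (2 * s * t * h) • x.2.2.2)
          ((2 * s * t) • x.2.2.2) 0 := by
        simpa using (((hasDerivAt_id (0 : ℝ)).const_mul (2 * s * t)).smul_const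
          x.2.2.2).const_add (s • x.2.1 + t • x.2.2.1)
      simpa [quadVertex_zero] using h1.clm_apply h2
    have hmm := (((hm 1 1).sub (hm 1 (-1))).sub (hm (-1) 1)).add (hm (-1) (-1))
    have hfun : ∀ h, _ = h ^ 2 • deriv φ h + (2 * h) • φ h := fun h =>
      ((hdM x h).congr_of_eventuallyEq
        (Filter.Eventually.of_forall fun k => (hGN x k).symm)).unique (hdF h)
    have hfin := (hmm.congr_of_eventuallyEq
      (Filter.Eventually.of_forall fun k => (hfun k).symm)).unique hdd
    have : φ 0 = (1 / 2 : ℝ) • ((2 : ℝ) • φ 0) := by module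
    change (1 / 4 : ℝ) • φ 0 = _
    rw [this, ← hfin]
    simp only [map_add, map_smul, add_apply, smul_apply]
    module
  · rw [show q = (q.1, q.2) from rfl, hGN]
    module

/-! ### Curvature lines and the leading parts of the defects. -/

theorem fderiv_apply_eq (L : ℝ × ℝ →L[ℝ] E3) (X : ℝ × ℝ) :
    L X = X.1 • L (1, 0) + X.2 • L (0, 1) := by
  rw [← map_smul, ← map_smul, ← map_add]
  congr 1
  ext <;> simp

theorem fderiv_fderiv_apply_eq (L : ℝ × ℝ →L[ℝ] ℝ × ℝ →L[ℝ] E3) (X Y : ℝ × ℝ) :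
    L X Y = (X.1 * Y.1) • L (1, 0) (1, 0) + (X.1 * Y.2) • L (1, 0) (0, 1)
      + (X.2 * Y.1) • L (0, 1) (1, 0) + (X.2 * Y.2) • L (0, 1) (0, 1) := by
  have hX : L X = X.1 • L (1, 0) + X.2 • L (0, 1) := by
    rw [← map_smul, ← map_smul, ← map_add]
    congr 1
    ext <;> simp
  rw [fderiv_apply_eq (L X), hX]
  simp only [add_apply, smul_apply]
  module

theorem secondForm_eq {g : ℝ × ℝ → E3} (hg : ContDiff ℝ ∞ g) (p X Y : ℝ × ℝ) :
    secondForm g p X Y = ‖cross (fderiv ℝ g p (1, 0)) (fderiv ℝ g p (0, 1))‖⁻¹ *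
      triple (fderiv ℝ g p (1, 0)) (fderiv ℝ g p (0, 1)) (fderiv ℝ (fderiv ℝ g) p X Y) := by
  have hdg : ContDiff ℝ ∞ (fderiv ℝ g) := hg.fderiv_right (by simp)
  have h1 : fderiv ℝ (fun q => fderiv ℝ g q Y) p X = fderiv ℝ (fderiv ℝ g) p X Y := by
    rw [fderiv_clm_apply (hdg.differentiable (by simp) p) (differentiableAt_const Y)]
    simp
  rw [secondForm, h1, unitNormal, inner_smul_right, inner_cross]

theorem fderiv_fderiv_comm {g : ℝ × ℝ → E3} (hg : ContDiff ℝ ∞ g) (p X Y : ℝ × ℝ) :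
    fderiv ℝ (fderiv ℝ g) p X Y = fderiv ℝ (fderiv ℝ g) p Y X :=
  ((contDiff_infty.1 hg 2).contDiffAt.isSymmSndFDerivAt (by simp)).eq X Y

theorem firstForm_eq_dot (g : ℝ × ℝ → E3) (p X Y : ℝ × ℝ) :
    firstForm g p X Y = dot (fderiv ℝ g p X) (fderiv ℝ g p Y) := inner_eq_dot _ _

theorem eq_zero_of_dot_self {a : E3} (h : dot a a = 0) : a = 0 := by
  rwa [← inner_eq_dot, inner_self_eq_zero] at h

theorem gram_ne_zero_of_injective {L : ℝ × ℝ →L[ℝ] E3} (hL : Function.Injective L) :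
    gram (L (1, 0)) (L (0, 1)) ≠ 0 := by
  intro h
  set a := L (1, 0)
  set b := L (0, 1)
  have hb : dot b b ≠ 0 := fun hb => by
    have h1 : L (0, 1) = L 0 := by rw [map_zero]; exact eq_zero_of_dot_self hb
    simpa using hL h1
  have hw : dot (dot b b • a - dot a b • b) (dot b b • a - dot a b • b) = dot b b * gram a b := by
    simp only [gram, dot, PiLp.sub_apply, PiLp.smul_apply, smul_eq_mul]; ring
  rw [h, mul_zero] at hw
  have h2 : L (dot b b, -dot a b) = L 0 := by
    rw [map_zero, fderiv_apply_eq, ← eq_zero_of_dot_self hw]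
    simp only [a, b]; module
  exact hb (congrArg Prod.fst (hL h2))

theorem norm_cross_sq (a b : E3) : ‖cross a b‖ ^ 2 = gram a b := by
  rw [← real_inner_self_eq_norm_sq, inner_cross]
  simp [triple, gram, dot, cross, cross_apply]
  ring

/-- Orthogonality, conjugacy and non-umbilicity of a net of curvature lines in terms of the
partial derivatives. -/
theorem derivatives_of_curvature_lines {g : ℝ × ℝ → E3} (hg : ContDiff ℝ ∞ g) {p : ℝ × ℝ}
    (hinj : Function.Injective (fderiv ℝ g p)) (hu : IsPrincipalDirection g p (1, 0))
    (hv : IsPrincipalDirection g p (0, 1)) (hnu : ¬ IsUmbilic g p) :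
    gram (fderiv ℝ g p (1, 0)) (fderiv ℝ g p (0, 1)) ≠ 0 ∧
    dot (fderiv ℝ g p (1, 0)) (fderiv ℝ g p (0, 1)) = 0 ∧
    triple (fderiv ℝ g p (1, 0)) (fderiv ℝ g p (0, 1))
      (fderiv ℝ (fderiv ℝ g) p (1, 0) (0, 1)) = 0 ∧
    triple (fderiv ℝ g p (1, 0)) (fderiv ℝ g p (0, 1)) (fderiv ℝ (fderiv ℝ g) p (1, 0) (1, 0))
      * dot (fderiv ℝ g p (0, 1)) (fderiv ℝ g p (0, 1))
    - triple (fderiv ℝ g p (1, 0)) (fderiv ℝ g p (0, 1)) (fderiv ℝ (fderiv ℝ g) p (0, 1) (0, 1))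
      * dot (fderiv ℝ g p (1, 0)) (fderiv ℝ g p (1, 0)) ≠ 0 := by
  obtain ⟨-, κ₁, h₁⟩ := hu
  obtain ⟨-, κ₂, h₂⟩ := hv
  have hgram := gram_ne_zero_of_injective hinj
  have hcomm := fderiv_fderiv_comm hg p (0, 1) (1, 0)
  have hlin := fun X Y => fderiv_fderiv_apply_eq (fderiv ℝ (fderiv ℝ g) p) X Y
  have hlin1 := fun X => fderiv_apply_eq (fderiv ℝ g p) X
  simp only [secondForm_eq hg, firstForm_eq_dot] at h₁ h₂
  simp only [IsUmbilic, secondForm_eq hg, firstForm_eq_dot] at hnu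
  have hN2 := norm_cross_sq (fderiv ℝ g p (1, 0)) (fderiv ℝ g p (0, 1))
  set a := fderiv ℝ g p (1, 0)
  set b := fderiv ℝ g p (0, 1)
  set P := fderiv ℝ (fderiv ℝ g) p (1, 0) (1, 0)
  set Q := fderiv ℝ (fderiv ℝ g) p (1, 0) (0, 1)
  set R := fderiv ℝ (fderiv ℝ g) p (0, 1) (0, 1)
  set ν := ‖cross a b‖ with hν
  have hν0 : ν ≠ 0 := fun h => hgram (by rw [← hN2, h]; norm_num)
  have e11 : ν⁻¹ * triple a b P = κ₁ * dot a a := h₁ (1, 0)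
  have e12 : ν⁻¹ * triple a b Q = κ₁ * dot a b := h₁ (0, 1)
  have e21 : ν⁻¹ * triple a b Q = κ₂ * dot b a := by rw [← hcomm]; exact h₂ (1, 0)
  have e22 : ν⁻¹ * triple a b R = κ₂ * dot b b := h₂ (0, 1)
  have hba : dot b a = dot a b := by simp only [dot]; ring
  have hne : κ₁ ≠ κ₂ := by
    rintro rfl
    refine hnu ⟨κ₁, fun X Y => ?_⟩
    have hX : triple a b ((X.1 * Y.1) • P + (X.1 * Y.2) • Q + (X.2 * Y.1) • Q + (X.2 * Y.2) • R) =
        X.1 * Y.1 * triple a b P + (X.1 * Y.2 + X.2 * Y.1) * triple a b Q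
          + X.2 * Y.2 * triple a b R := by
      simp only [triple, PiLp.add_apply, PiLp.smul_apply, smul_eq_mul]; ring
    have hI : dot (X.1 • a + X.2 • b) (Y.1 • a + Y.2 • b) =
        X.1 * Y.1 * dot a a + (X.1 * Y.2 + X.2 * Y.1) * dot a b + X.2 * Y.2 * dot b b := by
      simp only [dot, PiLp.add_apply, PiLp.smul_apply, smul_eq_mul]; ring
    rw [hlin X Y, hlin1 X, hlin1 Y, hcomm, hX, hI]
    linear_combination X.1 * Y.1 * e11 + (X.1 * Y.2 + X.2 * Y.1) * e12 + X.2 * Y.2 * e22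
  -- Symmetry of the second form gives `κ₁ * dot a b = κ₂ * dot a b`, and the principal curvatures
  -- differ.
  have hF : dot a b = 0 := by
    have : (κ₁ - κ₂) * dot a b = 0 := by rw [hba] at e21; linear_combination e21 - e12
    exact (mul_eq_zero.1 this).resolve_left (sub_ne_zero.2 hne)
  have hQ : triple a b Q = 0 := by
    rw [hF, mul_zero] at e12
    exact (mul_eq_zero.1 e12).resolve_left (inv_ne_zero hν0)
  refine ⟨hgram, hF, hQ, fun h0 => ?_⟩
  have h3 : (κ₁ - κ₂) * gram a b = 0 := by
    rw [gram, hF]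
    linear_combination ν⁻¹ * h0 - dot b b * e11 + dot a a * e22
  exact (mul_ne_zero (sub_ne_zero.2 hne) hgram) h3

/-- The values at mesh zero of the two concyclicity conditions. -/
theorem leading_defects {a b p q r : E3} (hF : dot a b = 0) (hQ : triple a b q = 0) (U V T : ℝ × ℝ) :
    triple (U.1 • a + U.2 • b) (V.1 • a + V.2 • b)
      ((U.1 * V.1) • p + (U.1 * V.2 + U.2 * V.1) • q + (U.2 * V.2) • r + (T.1 • a + T.2 • b)) =
      (U.1 * V.2 - U.2 * V.1) * (triple a b p * (U.1 * V.1) + triple a b r * (U.2 * V.2)) ∧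
    circDefect 0 (U.1 • a + U.2 • b) (V.1 • a + V.2 • b)
      ((U.1 * V.1) • p + (U.1 * V.2 + U.2 * V.1) • q + (U.2 * V.2) • r + (T.1 • a + T.2 • b)) =
      (dot a a * (U.1 * V.1) + dot b b * (U.2 * V.2)) *
        (gram a b * (U.1 * V.2 - U.2 * V.1) ^ 2) := by
  constructor
  · have h1 : triple (U.1 • a + U.2 • b) (V.1 • a + V.2 • b)
      ((U.1 * V.1) • p + (U.1 * V.2 + U.2 * V.1) • q + (U.2 * V.2) • r + (T.1 • a + T.2 • b)) =
      (U.1 * V.2 - U.2 * V.1) * (triple a b p * (U.1 * V.1)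
        + triple a b q * (U.1 * V.2 + U.2 * V.1) + triple a b r * (U.2 * V.2)) := by
      simp only [triple, PiLp.add_apply, PiLp.smul_apply, smul_eq_mul]; ring
    rw [h1, hQ]; ring
  · have hg : gram (U.1 • a + U.2 • b) (V.1 • a + V.2 • b) =
        gram a b * (U.1 * V.2 - U.2 * V.1) ^ 2 := by
      simp only [gram, dot, PiLp.add_apply, PiLp.smul_apply, smul_eq_mul]; ring
    have hd : dot (U.1 • a + U.2 • b) (V.1 • a + V.2 • b) =
        dot a a * (U.1 * V.1) + dot a b * (U.1 * V.2 + U.2 * V.1) + dot b b * (U.2 * V.2) := by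
      simp only [dot, PiLp.add_apply, PiLp.smul_apply, smul_eq_mul]; ring
    rw [circDefect, hg, hd, hF]; ring

/-- The two concyclicity conditions of a quadrilateral inscribed in the surface, as functions of
the parameter data: they are smooth, they differ from their leading parts by a factor `h ^ 2`,
and together they imply concyclicity. -/
theorem exists_smooth_defects {g : ℝ × ℝ → E3} (hg : ContDiff ℝ ∞ g) :
    ∃ P₁ P₂ : QuadData × ℝ → ℝ, ContDiff ℝ ∞ P₁ ∧ ContDiff ℝ ∞ P₂ ∧
      ∃ F₁ F₂ γ : QuadData × ℝ → ℝ,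
        (∀ x h, F₁ (x, h) = F₁ (x, 0) + h ^ 2 * P₁ (x, h)) ∧
        (∀ x h, F₂ (x, h) = F₂ (x, 0) + h ^ 2 * P₂ (x, h)) ∧ ContDiff ℝ ∞ γ ∧
        (∀ x : QuadData, γ (x, 0) = gram (fderiv ℝ g x.1 x.2.1) (fderiv ℝ g x.1 x.2.2.1)) ∧
        (∀ c U V T : ℝ × ℝ, dot (fderiv ℝ g c (1, 0)) (fderiv ℝ g c (0, 1)) = 0 →
          triple (fderiv ℝ g c (1, 0)) (fderiv ℝ g c (0, 1))
            (fderiv ℝ (fderiv ℝ g) c (1, 0) (0, 1)) = 0 →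
          F₁ ((c, U, V, T), 0) = (U.1 * V.2 - U.2 * V.1) *
            (triple (fderiv ℝ g c (1, 0)) (fderiv ℝ g c (0, 1))
              (fderiv ℝ (fderiv ℝ g) c (1, 0) (1, 0)) * (U.1 * V.1) +
            triple (fderiv ℝ g c (1, 0)) (fderiv ℝ g c (0, 1))
              (fderiv ℝ (fderiv ℝ g) c (0, 1) (0, 1)) * (U.2 * V.2)) ∧
          F₂ ((c, U, V, T), 0) =
            (dot (fderiv ℝ g c (1, 0)) (fderiv ℝ g c (1, 0)) * (U.1 * V.1) +
              dot (fderiv ℝ g c (0, 1)) (fderiv ℝ g c (0, 1)) * (U.2 * V.2)) *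
            (gram (fderiv ℝ g c (1, 0)) (fderiv ℝ g c (0, 1)) * (U.1 * V.2 - U.2 * V.1) ^ 2)) ∧
        ∀ q, γ q ≠ 0 → F₁ q = 0 → F₂ q = 0 → EuclideanGeometry.Concyclic
          ({g (quadVertex (-1) (-1) q), g (quadVertex 1 (-1) q), g (quadVertex 1 1 q),
            g (quadVertex (-1) 1 q)} : Set E3) := by
  obtain ⟨A, hA, hAe, hA0, hAq⟩ := exists_smooth_bimedian hg
  obtain ⟨M, hM, hMe, hM0, hMq⟩ := exists_smooth_mixed_quotient hg
  -- Exchanging `U` and `V` turns one bimedian quotient into the other.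
  let σ : QuadData × ℝ → QuadData × ℝ := fun q => ((q.1.1, q.1.2.2.1, q.1.2.1, q.1.2.2.2), q.2)
  have hσ : ContDiff ℝ ∞ σ := by fun_prop
  have hσv : ∀ s t q, quadVertex s t (σ q) = quadVertex t s q := by
    intro s t q
    simp only [quadVertex, σ, mul_comm t s]
    abel
  have hB : ContDiff ℝ ∞ fun q => A (σ q) := hA.comp hσ
  let F₁ : QuadData × ℝ → ℝ := fun q => triple (A q) (A (σ q)) (M q)
  let F₂ : QuadData × ℝ → ℝ := fun q => circDefect q.2 (A q) (A (σ q)) (M q)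
  have hBe : ∀ x h, A (σ (x, -h)) = A (σ (x, h)) := fun x h => hAe _ h
  obtain ⟨P₁, hP₁, hF₁⟩ := exists_smooth_sq_quotient_of_even (G := F₁) (contDiff_triple hA hB hM)
    (fun x h => by simp only [F₁, hAe, hBe, hMe])
  obtain ⟨P₂, hP₂, hF₂⟩ := exists_smooth_sq_quotient_of_even (G := F₂)
    (contDiff_circDefect contDiff_snd hA hB hM)
    (fun x h => by simp only [F₂, circDefect, hAe, hBe, hMe, neg_sq])
  refine ⟨P₁, P₂, hP₁, hP₂, F₁, F₂, fun q => gram (A q) (A (σ q)), hF₁, hF₂, contDiff_gram hA hB,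
    fun x => ?_, fun c U V T hF hQ => ?_, fun q hγ h1 h2 => ?_⟩
  · simp only [σ, hA0]
  · have hM0' : M ((c, U, V, T), 0) =
        (U.1 * V.1) • fderiv ℝ (fderiv ℝ g) c (1, 0) (1, 0)
        + (U.1 * V.2 + U.2 * V.1) • fderiv ℝ (fderiv ℝ g) c (1, 0) (0, 1)
        + (U.2 * V.2) • fderiv ℝ (fderiv ℝ g) c (0, 1) (0, 1)
        + (T.1 • fderiv ℝ g c (1, 0) + T.2 • fderiv ℝ g c (0, 1)) := by
      rw [hM0]
      dsimp only
      rw [fderiv_fderiv_comm hg c V U, ← two_smul ℝ, smul_smul,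
        fderiv_fderiv_apply_eq _ U V, fderiv_fderiv_comm hg c (0, 1) (1, 0), fderiv_apply_eq _ T]
      module
    have := leading_defects (p := fderiv ℝ (fderiv ℝ g) c (1, 0) (1, 0))
      (r := fderiv ℝ (fderiv ℝ g) c (0, 1) (0, 1)) hF hQ U V T
    simp only [F₁, F₂, σ, hM0', hA0]
    rwa [fderiv_apply_eq _ U, fderiv_apply_eq _ V]
  · have hAq' := hAq (σ q)
    have hAq := hAq q
    have hMq := hMq q
    simp only [hσv] at hAq'
    change _ = (4 * q.2) • A (σ q) at hAq'
    have hc := concyclic_of_defects_eq_zero (m := (1 / 4 : ℝ) • (g (quadVertex 1 1 q)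
      + g (quadVertex 1 (-1) q) + g (quadVertex (-1) 1 q) + g (quadVertex (-1) (-1) q)))
      (h := q.2) hγ h1 h2
    have eA : q.2 • A q = (1 / 4 : ℝ) • ((4 * q.2) • A q) := by module
    have eB : q.2 • A (σ q) = (1 / 4 : ℝ) • ((4 * q.2) • A (σ q)) := by module
    have eM : q.2 ^ 2 • M q = (1 / 4 : ℝ) • ((4 * q.2 ^ 2) • M q) := by module
    rw [eA, eB, eM, ← hAq, ← hAq', ← hMq] at hc
    convert hc using 2
    · module
    · congr 1
      · module
      · congr 1
        · module
        · congr 1; module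

/-! ### Solving the circularity conditions by Lipschitz functions. -/

theorem convex_closedUnitDisc : Convex ℝ closedUnitDisc := by
  intro p hp q hq a b ha hb hab
  simp only [closedUnitDisc, Set.mem_ofPred_eq, Prod.fst_add, Prod.snd_add, Prod.smul_fst,
    Prod.smul_snd, smul_eq_mul] at *
  obtain rfl : b = 1 - a := by linarith
  nlinarith [mul_nonneg ha hb, sq_nonneg (p.1 - q.1), sq_nonneg (p.2 - q.2),
    mul_nonneg (mul_nonneg ha hb) (add_nonneg (sq_nonneg (p.1 - q.1)) (sq_nonneg (p.2 - q.2)))]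

theorem isCompact_closedUnitDisc : IsCompact closedUnitDisc := by
  refine Metric.isCompact_of_isClosed_isBounded
    (isClosed_le (by fun_prop) continuous_const) ?_
  refine (Metric.isBounded_closedBall (x := (0 : ℝ × ℝ)) (r := 1)).subset fun p hp => ?_
  simp only [closedUnitDisc, Set.mem_ofPred_eq] at hp
  rw [mem_closedBall_zero_iff, Prod.norm_def, sup_le_iff, Real.norm_eq_abs, Real.norm_eq_abs]
  exact ⟨abs_le_one_iff_mul_self_le_one.2 (by nlinarith [sq_nonneg p.2]),
    abs_le_one_iff_mul_self_le_one.2 (by nlinarith [sq_nonneg p.1])⟩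

/-- The concyclicity of small quadrilaterals inscribed in a surface patch along its curvature
lines is governed by two Lipschitz functions. -/
theorem exists_lipschitz_circularity {g : ℝ × ℝ → E3} (hg : ContDiff ℝ ∞ g)
    (hcurv : IsCurvatureLineParametrization g closedUnitDisc)
    (humb : ∀ p ∈ closedUnitDisc, ¬ IsUmbilic g p) :
    ∃ r : ℝ, 0 < r ∧ ∃ (Λ : NNReal) (R₁ R₂ : QuadData × ℝ → ℝ),
      LipschitzWith Λ R₁ ∧ LipschitzWith Λ R₂ ∧
      ∀ q : QuadData × ℝ, q.1.1 ∈ closedUnitDisc → dist q (squareData 0 q.1.1) ≤ r →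
        q.1.2.2.1.1 = q.2 ^ 2 * R₁ q → q.1.2.1.2 = q.2 ^ 2 * R₂ q →
        EuclideanGeometry.Concyclic
          ({g (quadVertex (-1) (-1) q), g (quadVertex 1 (-1) q), g (quadVertex 1 1 q),
            g (quadVertex (-1) 1 q)} : Set E3) := by
  obtain ⟨P₁, P₂, hP₁, hP₂, F₁, F₂, γ, hF₁, hF₂, hγ, hγ0, hF0, hconc⟩ := exists_smooth_defects hg
  have hder : ∀ p ∈ closedUnitDisc, _ := fun p hp =>
    derivatives_of_curvature_lines hg (hcurv p hp).1 (hcurv p hp).2.1 (hcurv p hp).2.2 (humb p hp)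
  have hdg : ContDiff ℝ ∞ (fderiv ℝ g) := hg.fderiv_right (by simp)
  have hddg : ContDiff ℝ ∞ (fderiv ℝ (fderiv ℝ g)) := hdg.fderiv_right (by simp)
  have hcoord : ContDiff ℝ ∞ fun q : QuadData × ℝ => q.1.1 := by fun_prop
  have ha : ∀ X : ℝ × ℝ, ContDiff ℝ ∞ fun q : QuadData × ℝ => fderiv ℝ g q.1.1 X := fun X =>
    (hdg.comp hcoord).clm_apply contDiff_const
  have hp : ∀ X Y : ℝ × ℝ, ContDiff ℝ ∞ fun q : QuadData × ℝ =>
      fderiv ℝ (fderiv ℝ g) q.1.1 X Y := fun X Y =>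
    ((hddg.comp hcoord).clm_apply contDiff_const).clm_apply contDiff_const
  let E : QuadData × ℝ → ℝ := fun q => dot (fderiv ℝ g q.1.1 (1, 0)) (fderiv ℝ g q.1.1 (1, 0))
  let G : QuadData × ℝ → ℝ := fun q => dot (fderiv ℝ g q.1.1 (0, 1)) (fderiv ℝ g q.1.1 (0, 1))
  let J : QuadData × ℝ → ℝ := fun q => gram (fderiv ℝ g q.1.1 (1, 0)) (fderiv ℝ g q.1.1 (0, 1))
  let l : QuadData × ℝ → ℝ := fun q => triple (fderiv ℝ g q.1.1 (1, 0)) (fderiv ℝ g q.1.1 (0, 1))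
    (fderiv ℝ (fderiv ℝ g) q.1.1 (1, 0) (1, 0))
  let n : QuadData × ℝ → ℝ := fun q => triple (fderiv ℝ g q.1.1 (1, 0)) (fderiv ℝ g q.1.1 (0, 1))
    (fderiv ℝ (fderiv ℝ g) q.1.1 (0, 1) (0, 1))
  let κ : QuadData × ℝ → ℝ := fun q => q.1.2.1.1 * q.1.2.2.1.2 - q.1.2.1.2 * q.1.2.2.1.1
  have hE : ContDiff ℝ ∞ E := contDiff_dot (ha _) (ha _)
  have hG : ContDiff ℝ ∞ G := contDiff_dot (ha _) (ha _)
  have hJ : ContDiff ℝ ∞ J := contDiff_gram (ha _) (ha _)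
  have hl : ContDiff ℝ ∞ l := contDiff_triple (ha _) (ha _) (hp _ _)
  have hn : ContDiff ℝ ∞ n := contDiff_triple (ha _) (ha _) (hp _ _)
  have hκ : ContDiff ℝ ∞ κ := by fun_prop
  have hU : ContDiff ℝ ∞ fun q : QuadData × ℝ => q.1.2.1.1 := by fun_prop
  have hV : ContDiff ℝ ∞ fun q : QuadData × ℝ => q.1.2.2.1.2 := by fun_prop
  let den : QuadData × ℝ → ℝ := fun q =>
    κ q * J q * (l q * G q - n q * E q) * q.1.2.1.1 * q.1.2.2.1.2 * γ q
  have hden : ContDiff ℝ ∞ den :=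
    ((((hκ.mul hJ).mul ((hl.mul hG).sub (hn.mul hE))).mul hU).mul hV).mul hγ
  let O : Set (QuadData × ℝ) := {q | den q ≠ 0}
  have hO : IsOpen O := isOpen_ne_fun hden.continuous continuous_const
  -- Cramer's rule for the linear system in `U.1 * V.1` and `U.2 * V.2`, followed by division by
  -- `U.1` or `V.2`, both equal to 1 on the model squares. `den` collects every denominator together
  -- with `γ`.
  let S₁ : QuadData × ℝ → ℝ := fun q =>
    -((G q * (P₁ q / κ q) - n q * (P₂ q / (J q * κ q ^ 2))) / (l q * G q - n q * E q)) / q.1.2.1.1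
  let S₂ : QuadData × ℝ → ℝ := fun q =>
    -((l q * (P₂ q / (J q * κ q ^ 2)) - E q * (P₁ q / κ q)) / (l q * G q - n q * E q)) / q.1.2.2.1.2
  have hO' : ∀ q ∈ O, κ q ≠ 0 ∧ J q ≠ 0 ∧ l q * G q - n q * E q ≠ 0 ∧ q.1.2.1.1 ≠ 0 ∧
      q.1.2.2.1.2 ≠ 0 ∧ γ q ≠ 0 := by
    intro q hq
    simp only [O, den, Set.mem_ofPred_eq, ne_eq, mul_eq_zero, not_or] at hq
    tauto
  have h1 : ContDiffOn ℝ ∞ (fun q => P₁ q / κ q) O :=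
    hP₁.contDiffOn.div hκ.contDiffOn fun q hq => (hO' q hq).1
  have h2 : ContDiffOn ℝ ∞ (fun q => P₂ q / (J q * κ q ^ 2)) O :=
    hP₂.contDiffOn.div (hJ.mul (hκ.pow 2)).contDiffOn fun q hq =>
      mul_ne_zero (hO' q hq).2.1 (pow_ne_zero 2 (hO' q hq).1)
  have h3 : ContDiffOn ℝ ∞ (fun q => l q * G q - n q * E q) O := ((hl.mul hG).sub (hn.mul hE)).contDiffOn
  have hS₁ : ContDiffOn ℝ ∞ S₁ O :=
    (((hG.contDiffOn.mul h1).sub (hn.contDiffOn.mul h2)).div h3 fun q hq => (hO' q hq).2.2.1).neg.div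
      hU.contDiffOn fun q hq => (hO' q hq).2.2.2.1
  have hS₂ : ContDiffOn ℝ ∞ S₂ O :=
    (((hl.contDiffOn.mul h2).sub (hE.contDiffOn.mul h1)).div h3 fun q hq => (hO' q hq).2.2.1).neg.div
      hV.contDiffOn fun q hq => (hO' q hq).2.2.2.2.1
  -- the model squares centred in the disc
  have hsq : Continuous (squareData 0) := by unfold squareData; fun_prop
  have hK₀ : IsCompact (squareData 0 '' closedUnitDisc) := isCompact_closedUnitDisc.image hsq
  have hK₀O : squareData 0 '' closedUnitDisc ⊆ O := by
    rintro _ ⟨c, hc, rfl⟩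
    obtain ⟨d1, -, -, d4⟩ := hder c hc
    have hγc : γ (squareData 0 c) ≠ 0 := by
      rw [squareData, hγ0]; exact d1
    simp only [O, den, Set.mem_ofPred_eq]
    refine mul_ne_zero (mul_ne_zero (mul_ne_zero (mul_ne_zero (mul_ne_zero ?_ d1) d4) ?_) ?_) hγc <;>
      simp [κ, squareData]
  obtain ⟨r, hr, hrO⟩ := hK₀.exists_cthickening_subset_open hO hK₀O
  -- A product of compact convex sets inside `O`: smooth functions are Lipschitz on it, and
  -- real-valued Lipschitz functions extend to the whole space, so the Goursat problem needs no
  -- domain restrictions.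
  let K : Set (QuadData × ℝ) := (closedUnitDisc ×ˢ Metric.closedBall (1, 0) r ×ˢ
    Metric.closedBall (0, 1) r ×ˢ Metric.closedBall 0 r) ×ˢ Metric.closedBall 0 r
  have hKmem : ∀ q : QuadData × ℝ, q ∈ K ↔ q.1.1 ∈ closedUnitDisc ∧ dist q (squareData 0 q.1.1) ≤ r := by
    intro q
    simp only [K, Set.mem_prod, Metric.mem_closedBall, squareData, Prod.dist_eq, sup_le_iff, dist_self]
    simp only [hr.le, true_and]
    tauto
  have hKO : K ⊆ O := fun q hq => hrO <| Metric.mem_cthickening_of_dist_le q _ r _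
    ⟨q.1.1, ((hKmem q).1 hq).1, rfl⟩ ((hKmem q).1 hq).2
  have hKc : IsCompact K := (isCompact_closedUnitDisc.prod ((isCompact_closedBall _ _).prod
    ((isCompact_closedBall _ _).prod (isCompact_closedBall _ _)))).prod (isCompact_closedBall _ _)
  have hKv : Convex ℝ K := (convex_closedUnitDisc.prod ((convex_closedBall _ _).prod
    ((convex_closedBall _ _).prod (convex_closedBall _ _)))).prod (convex_closedBall _ _)
  obtain ⟨Λ₁, hΛ₁⟩ := (hS₁.mono hKO).exists_lipschitzOnWith (by simp) hKv hKc
  obtain ⟨Λ₂, hΛ₂⟩ := (hS₂.mono hKO).exists_lipschitzOnWith (by simp) hKv hKc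
  obtain ⟨R₁, hR₁, hR₁S⟩ := hΛ₁.extend_real
  obtain ⟨R₂, hR₂, hR₂S⟩ := hΛ₂.extend_real
  refine ⟨r, hr, max Λ₁ Λ₂, R₁, R₂, hR₁.weaken (le_max_left _ _), hR₂.weaken (le_max_right _ _),
    fun q hqd hqr hq1 hq2 => ?_⟩
  have hqK : q ∈ K := (hKmem q).2 ⟨hqd, hqr⟩
  rw [← hR₁S hqK] at hq1
  rw [← hR₂S hqK] at hq2
  obtain ⟨k1, k2, k3, k4, k5, k6⟩ := hO' q (hKO hqK)
  obtain ⟨-, d2, d3, -⟩ := hder _ hqd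
  obtain ⟨f1, f2⟩ := hF0 q.1.1 q.1.2.1 q.1.2.2.1 q.1.2.2.2 d2 d3
  set x := q.1.2.1.1 * q.1.2.2.1.1 with hx
  set y := q.1.2.1.2 * q.1.2.2.1.2 with hy
  have hx' : x = -q.2 ^ 2 * ((G q * (P₁ q / κ q) - n q * (P₂ q / (J q * κ q ^ 2))) /
      (l q * G q - n q * E q)) := by
    rw [hx, hq1]; simp only [S₁]
    generalize (G q * (P₁ q / κ q) - n q * (P₂ q / (J q * κ q ^ 2))) / (l q * G q - n q * E q) = z
    field_simp
  have hy' : y = -q.2 ^ 2 * ((l q * (P₂ q / (J q * κ q ^ 2)) - E q * (P₁ q / κ q)) /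
      (l q * G q - n q * E q)) := by
    rw [hy, hq2]; simp only [S₂]
    generalize (l q * (P₂ q / (J q * κ q ^ 2)) - E q * (P₁ q / κ q)) / (l q * G q - n q * E q) = z
    field_simp
  have e1 : l q * x + n q * y = -q.2 ^ 2 * (P₁ q / κ q) := by
    rw [hx', hy']
    generalize P₁ q / κ q = z
    generalize P₂ q / (J q * κ q ^ 2) = z'
    have hz : (l q * G q - n q * E q) * z / (l q * G q - n q * E q) = z :=
      mul_div_cancel_left₀ z k3
    linear_combination (-q.2 ^ 2) * hz
  have e2 : E q * x + G q * y = -q.2 ^ 2 * (P₂ q / (J q * κ q ^ 2)) := by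
    rw [hx', hy']
    generalize P₁ q / κ q = z
    generalize P₂ q / (J q * κ q ^ 2) = z'
    have hz : (l q * G q - n q * E q) * z' / (l q * G q - n q * E q) = z' :=
      mul_div_cancel_left₀ z' k3
    linear_combination (-q.2 ^ 2) * hz
  refine hconc q k6 ?_ ?_
  · have : F₁ q = κ q * (l q * x + n q * y) + q.2 ^ 2 * P₁ q := (hF₁ q.1 q.2).trans (by rw [← f1])
    rw [this, e1]
    field_simp
    ring
  · have : F₂ q = (E q * x + G q * y) * (J q * κ q ^ 2) + q.2 ^ 2 * P₂ q :=
      (hF₂ q.1 q.2).trans (by rw [← f2])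
    rw [this, e2]
    field_simp
    ring

/-! ### Globalising the map and keeping displaced nodes in the disc. -/

open scoped Manifold Topology in
/-- A map that is smooth near a compact set agrees near that set with a globally smooth map. -/
theorem exists_contDiff_eventuallyEq {f : ℝ × ℝ → E3} {U S : Set (ℝ × ℝ)} (hU : IsOpen U)
    (hS : IsCompact S) (hSU : S ⊆ U) (hf : ContDiffOn ℝ ∞ f U) :
    ∃ g : ℝ × ℝ → E3, ContDiff ℝ ∞ g ∧ ∀ p ∈ S, g =ᶠ[𝓝 p] f := by
  obtain ⟨W, hW, hSW, hWU⟩ := exists_compact_between hS hU hSU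
  obtain ⟨χ, hχ1, hχ0, -⟩ := exists_contMDiffMap_one_nhds_of_subset_interior 𝓘(ℝ, ℝ × ℝ) (n := ⊤)
    hS.isClosed hSW
  have hχ : ContDiff ℝ ∞ χ := χ.contMDiff.contDiff
  refine ⟨fun x => χ x • f x, contDiff_iff_contDiffAt.2 fun x => ?_, fun p hp => ?_⟩
  · by_cases hx : x ∈ U
    · exact hχ.contDiffAt.smul (hf.contDiffAt (hU.mem_nhds hx))
    · have : (fun x => χ x • f x) =ᶠ[𝓝 x] fun _ => 0 := by
        filter_upwards [hW.isClosed.isOpen_compl.mem_nhds fun h => hx (hWU h)] with y hy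
        rw [hχ0 y hy, zero_smul]
      exact contDiffAt_const.congr_of_eventuallyEq this
  · filter_upwards [Filter.eventually_of_mem (nhds_le_nhdsSet hp hχ1) fun y hy => hy] with y hy
    rw [hy, one_smul]

open scoped Topology in
theorem firstForm_congr {f g : ℝ × ℝ → E3} {p : ℝ × ℝ} (h : g =ᶠ[𝓝 p] f) (X Y : ℝ × ℝ) :
    firstForm g p X Y = firstForm f p X Y := by
  simp only [firstForm, h.fderiv_eq]

open scoped Topology in
theorem secondForm_congr {f g : ℝ × ℝ → E3} {p : ℝ × ℝ} (h : g =ᶠ[𝓝 p] f) (X Y : ℝ × ℝ) :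
    secondForm g p X Y = secondForm f p X Y := by
  have h2 : (fun q => fderiv ℝ g q Y) =ᶠ[𝓝 p] fun q => fderiv ℝ f q Y := by
    filter_upwards [h.fderiv (𝕜 := ℝ)] with q hq
    rw [hq]
  simp only [secondForm, unitNormal, h.fderiv_eq, h2.fderiv_eq]

theorem quadVertex_cellData (h : ℝ) (p : ℝ × ℝ) (i j : ℕ) (w₀₀ w₁₀ w₀₁ w₁₁ : ℝ × ℝ) :
    quadVertex (-1) (-1) (cellData h (cellCenter p h i j) w₀₀ w₁₀ w₀₁ w₁₁)
      = (p.1 + 2 * h * i, p.2 + 2 * h * j) + h ^ 2 • w₀₀ ∧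
    quadVertex 1 (-1) (cellData h (cellCenter p h i j) w₀₀ w₁₀ w₀₁ w₁₁)
      = (p.1 + 2 * h * (i + 1 : ℕ), p.2 + 2 * h * j) + h ^ 2 • w₁₀ ∧
    quadVertex 1 1 (cellData h (cellCenter p h i j) w₀₀ w₁₀ w₀₁ w₁₁)
      = (p.1 + 2 * h * (i + 1 : ℕ), p.2 + 2 * h * (j + 1 : ℕ)) + h ^ 2 • w₁₁ ∧
    quadVertex (-1) 1 (cellData h (cellCenter p h i j) w₀₀ w₁₀ w₀₁ w₁₁)
      = (p.1 + 2 * h * i, p.2 + 2 * h * (j + 1 : ℕ)) + h ^ 2 • w₀₁ := by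
  refine ⟨?_, ?_, ?_, ?_⟩ <;> ext <;> simp [quadVertex, cellData, cellCenter] <;> ring

/-- The centre is an iterated midpoint of the vertices, so by convexity it lies in the closed disc
when they do. -/
theorem quadVertex_sum (q : QuadData × ℝ) :
    q.1.1 = (1 / 2 : ℝ) • ((1 / 2 : ℝ) • quadVertex (-1) (-1) q + (1 / 2 : ℝ) • quadVertex 1 (-1) q)
      + (1 / 2 : ℝ) • ((1 / 2 : ℝ) • quadVertex 1 1 q + (1 / 2 : ℝ) • quadVertex (-1) 1 q) := by
  simp only [quadVertex]
  module

theorem unitDisc_subset : unitDisc ⊆ closedUnitDisc := by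
  intro p hp
  simp only [unitDisc, closedUnitDisc, Set.mem_ofPred_eq] at *
  exact hp.le

/-- A point of the disc stays in the disc if it is first contracted and then moved a little. -/
theorem add_mem_unitDisc {p d : ℝ × ℝ} {δ : ℝ} (hp : p ∈ unitDisc) (hδ : 4 * δ < 1)
    (hd : ‖d‖ ≤ δ) : (1 - 4 * δ) • p + d ∈ unitDisc := by
  have hδ0 : 0 ≤ δ := (norm_nonneg d).trans hd
  simp only [Prod.norm_def, sup_le_iff, Real.norm_eq_abs] at hd
  simp only [unitDisc, Set.mem_ofPred_eq, Prod.fst_add, Prod.snd_add, Prod.smul_fst, Prod.smul_snd,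
    smul_eq_mul] at *
  have h1 : |p.1| ≤ 1 := abs_le_one_iff_mul_self_le_one.2 (by nlinarith [sq_nonneg p.2])
  have h2 : |p.2| ≤ 1 := abs_le_one_iff_mul_self_le_one.2 (by nlinarith [sq_nonneg p.1])
  have e1 : p.1 * d.1 ≤ δ := (le_abs_self _).trans (by
    rw [abs_mul]; nlinarith [abs_nonneg p.1, abs_nonneg d.1])
  have e2 : p.2 * d.2 ≤ δ := (le_abs_self _).trans (by
    rw [abs_mul]; nlinarith [abs_nonneg p.2, abs_nonneg d.2])
  have e3 : d.1 ^ 2 ≤ δ ^ 2 := sq_le_sq' (by linarith [neg_abs_le d.1]) ((le_abs_self _).trans hd.1)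
  have e4 : d.2 ^ 2 ≤ δ ^ 2 := sq_le_sq' (by linarith [neg_abs_le d.2]) ((le_abs_self _).trans hd.2)
  have hρ : 0 < 1 - 4 * δ := by linarith
  have e5 := mul_le_mul_of_nonneg_left (add_le_add e1 e2) hρ.le
  -- With `ρ = 1 - 4 δ` the squared length is below `ρ ^ 2 + 4 ρ δ + 2 δ ^ 2 = 1 - 4 δ + 2 δ ^ 2`,
  -- which is at most 1.
  have e6 := mul_lt_mul_of_pos_left hp (pow_pos hρ 2)
  nlinarith

theorem dist_cellData_squareData_zero_le {h : ℝ} (hh : 0 ≤ h) (c w₀₀ w₁₀ w₀₁ w₁₁ : ℝ × ℝ) :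
    dist (cellData h c w₀₀ w₁₀ w₀₁ w₁₁) (squareData 0 (cellData h c w₀₀ w₁₀ w₀₁ w₁₁).1.1)
      ≤ max (dist (cellData h c w₀₀ w₁₀ w₀₁ w₁₁) (squareData h c)) h := by
  simp only [cellData, squareData, Prod.dist_eq, dist_self, Real.dist_eq, sub_zero, abs_of_nonneg hh]
  refine max_le (max_le ?_ ?_) (le_max_right _ _)
  · exact le_max_of_le_right hh
  · exact le_max_of_le_left (le_max_of_le_left (le_max_right _ _))

end CurvNet

/-! ### Assembling the circular net. -/

open CurvNet

theorem mainTheorem9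
    (f : ℝ × ℝ → CurvNet.E3) (U : Set (ℝ × ℝ))
    (hU : IsOpen U) (hdisc : CurvNet.closedUnitDisc ⊆ U)
    (hf : ContDiffOn ℝ ∞ f U)
    (hcurv : CurvNet.IsCurvatureLineParametrization f CurvNet.closedUnitDisc)
    (humb : ∀ p ∈ CurvNet.closedUnitDisc, ¬ CurvNet.IsUmbilic f p) :
    ∃ C : ℝ, 0 < C ∧ ∃ ε₀ : ℝ, 0 < ε₀ ∧
      ∀ ε : ℝ, 0 < ε → ε < ε₀ → ∀ p₀ ∈ CurvNet.unitDisc,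
        ∃ F : ℤ → ℤ → CurvNet.E3,
          CurvNet.IsCircularNetOn
            {ij : ℤ × ℤ | CurvNet.gridPoint p₀ ε ij.1 ij.2 ∈ CurvNet.unitDisc} F ∧
          ∀ i j : ℤ, CurvNet.gridPoint p₀ ε i j ∈ CurvNet.unitDisc →
            F i j ∈ f '' CurvNet.unitDisc ∧
            dist (f (CurvNet.gridPoint p₀ ε i j)) (F i j) ≤ C * ε ^ 2 := by
  obtain ⟨g, hg, hgf⟩ := exists_contDiff_eventuallyEq hU isCompact_closedUnitDisc hdisc hf
  have hgf' : ∀ p ∈ unitDisc, g p = f p := fun p hp => (hgf p (unitDisc_subset hp)).eq_of_nhds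
  have hcurvg : IsCurvatureLineParametrization g closedUnitDisc := by
    intro p hp
    have := hcurv p hp
    simp only [IsPrincipalDirection] at this ⊢
    simpa only [firstForm_congr (hgf p hp), secondForm_congr (hgf p hp), (hgf p hp).fderiv_eq] using this
  have humbg : ∀ p ∈ closedUnitDisc, ¬ IsUmbilic g p := by
    intro p hp
    have := humb p hp
    simp only [IsUmbilic] at this ⊢
    simpa only [firstForm_congr (hgf p hp), secondForm_congr (hgf p hp)] using this
  obtain ⟨r, hr, Λ, R₁, R₂, hR₁, hR₂, hcirc⟩ := exists_lipschitz_circularity hg hcurvg humbg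
  obtain ⟨K, hK1, h₀, hh₀, hlat⟩ := exists_lattice_displacement hR₁ hR₂
  obtain ⟨L, hL⟩ := hg.contDiffOn.exists_lipschitzOnWith (by simp) convex_closedUnitDisc
    isCompact_closedUnitDisc
  have hK0 : 0 < K := by linarith
  have hL0 : (0 : ℝ) ≤ L := L.2
  -- A node moves by at most `4 δ` through the contraction and `δ` through the displacement, and `5
  -- δ = (5 / 4) K ε ^ 2`. The bounds on `ε` by `r / K` and `1 / K` keep the cells within `r` of
  -- model squares and ensure `4 * δ < 1`.
  refine ⟨L * (5 / 4 * K) + 1, by positivity, min 1 (min h₀ (min (r / K) (1 / K))),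
    by positivity, fun ε hε hεε p₀ hp₀ => ?_⟩
  obtain ⟨hε1, hεε⟩ := lt_min_iff.1 hεε
  obtain ⟨hεh, hεε⟩ := lt_min_iff.1 hεε
  obtain ⟨hεr, hεK⟩ := lt_min_iff.1 hεε
  rw [lt_div_iff₀ hK0] at hεr hεK
  set δ := ε ^ 2 * K / 4 with hδ
  have hδ0 : 0 < δ := by positivity
  have hδ1 : 4 * δ < 1 := by
    have : ε * (ε * K) < 1 * 1 := mul_lt_mul'' hε1 hεK hε.le (by positivity)
    rw [hδ]; linarith
  set ρ := 1 - 4 * δ with hρ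
  have hρ0 : 0 < ρ := by linarith
  have hρ1 : ρ ≤ 1 := by linarith
  -- Half the mesh of the grid after contraction by `ρ` towards the origin.
  set h := ρ * ε / 2 with hh
  have hhpos : 0 < h := by positivity
  have hhε : h ≤ ε / 2 := by
    have := mul_le_mul_of_nonneg_right hρ1 hε.le
    rw [hh]; linarith
  -- Grid indices in the disc satisfy `|i| ε ≤ 2`, so shifting by `n` makes them natural numbers;
  -- `b` is the corner of the shifted, contracted lattice.
  set n := ⌈2 / ε⌉₊ with hn
  have hn1 : 2 ≤ n * ε := by
    have := Nat.le_ceil (2 / ε)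
    rwa [div_le_iff₀ hε] at this
  have hn2 : n * ε ≤ 3 := by
    have := (Nat.ceil_lt_add_one (by positivity : 0 ≤ 2 / ε)).le
    have h2 := mul_le_mul_of_nonneg_right this hε.le
    rw [add_mul, div_mul_cancel₀ _ hε.ne'] at h2
    linarith
  have habs : ∀ p ∈ unitDisc, |p.1| ≤ 1 ∧ |p.2| ≤ 1 := by
    intro p hp
    simp only [unitDisc, Set.mem_ofPred_eq] at hp
    exact ⟨abs_le_one_iff_mul_self_le_one.2 (by nlinarith [sq_nonneg p.2]),
      abs_le_one_iff_mul_self_le_one.2 (by nlinarith [sq_nonneg p.1])⟩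
  let b : ℝ × ℝ := (ρ * p₀.1 - n * (ρ * ε), ρ * p₀.2 - n * (ρ * ε))
  have hb : ‖b‖ ≤ 10 := by
    have key : ∀ x : ℝ, |x| ≤ 1 → |ρ * x - n * (ρ * ε)| ≤ 10 := by
      intro x hx
      rw [show ρ * x - n * (ρ * ε) = ρ * (x - n * ε) by ring, abs_mul, abs_of_pos hρ0]
      have h1 : |x - n * ε| ≤ 4 := by
        rw [abs_le] at hx ⊢
        constructor <;> linarith
      nlinarith [abs_nonneg (x - n * ε)]
    rw [Prod.norm_def]
    exact max_le (key _ (habs p₀ hp₀).1) (key _ (habs p₀ hp₀).2)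
  obtain ⟨w, hw⟩ := hlat h hhpos (by linarith) b hb
  let x : ℕ → ℕ → ℝ × ℝ := fun i j => (b.1 + 2 * h * i, b.2 + 2 * h * j) + h ^ 2 • w i j
  -- the indices of the grid points in the disc, shifted to the quadrant
  have hidx : ∀ i j : ℤ, gridPoint p₀ ε i j ∈ unitDisc → ∃ k l : ℕ,
      i + n = k ∧ j + n = l ∧ (k + l : ℕ) * h ≤ 10 ∧
      (b.1 + 2 * h * k, b.2 + 2 * h * l) = ρ • gridPoint p₀ ε i j := by
    intro i j hij
    have key : ∀ (y : ℝ) (i : ℤ), |y| ≤ 1 → |y + i * ε| ≤ 1 → ∃ k : ℕ, i + n = k ∧ k * h ≤ 5 := by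
      intro y i hy hi
      rw [abs_le] at hy hi
      have h1 : (0 : ℝ) ≤ (i + n) * ε := by linarith
      have h2 : (0 : ℝ) ≤ i + n := nonneg_of_mul_nonneg_left h1 hε
      have h3 : 0 ≤ i + n := by exact_mod_cast h2
      obtain ⟨k, hk⟩ := Int.eq_ofNat_of_zero_le h3
      refine ⟨k, hk, ?_⟩
      have hk' : (i : ℝ) + n = k := by exact_mod_cast hk
      have := mul_le_mul_of_nonneg_left hhε (Nat.cast_nonneg (α := ℝ) k)
      rw [← hk'] at this ⊢
      linarith
    obtain ⟨k, hk, hkh⟩ := key p₀.1 i (habs p₀ hp₀).1 (habs _ hij).1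
    obtain ⟨l, hl, hlh⟩ := key p₀.2 j (habs p₀ hp₀).2 (habs _ hij).2
    have hk' : (i : ℝ) + n = k := by exact_mod_cast hk
    have hl' : (j : ℝ) + n = l := by exact_mod_cast hl
    refine ⟨k, l, hk, hl, by push_cast; linarith, ?_⟩
    ext
    · simp only [b, gridPoint, Prod.smul_mk, smul_eq_mul, ← hk', hh]; ring
    · simp only [b, gridPoint, Prod.smul_mk, smul_eq_mul, ← hl', hh]; ring
  have hhδ : h ^ 2 * K ≤ δ := by
    have := pow_le_pow_left₀ hhpos.le hhε 2
    have := mul_le_mul_of_nonneg_right this hK0.le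
    rw [hδ]; linarith
  have hdisp : ∀ k l : ℕ, (k + l : ℕ) * h ≤ 10 → ‖h ^ 2 • w k l‖ ≤ δ := by
    intro k l hkl
    rw [norm_smul, Real.norm_eq_abs, abs_of_nonneg (by positivity)]
    exact (mul_le_mul_of_nonneg_left (hw k l hkl).1 (by positivity)).trans hhδ
  have hx : ∀ (i j : ℤ) (k l : ℕ), gridPoint p₀ ε i j ∈ unitDisc → i + n = k → j + n = l →
      x k l ∈ unitDisc ∧ (k + l : ℕ) * h ≤ 10 := by
    intro i j k l hij hk hl
    obtain ⟨k', l', hk', hl', hkl, hgrid⟩ := hidx i j hij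
    obtain rfl : k = k' := by omega
    obtain rfl : l = l' := by omega
    refine ⟨?_, hkl⟩
    simp only [x, hgrid]
    exact add_mem_unitDisc hij hδ1 (hdisp k l hkl)
  -- Truncation by `toNat` affects only indices whose grid point lies outside the disc.
  refine ⟨fun i j => f (x (i + n).toNat (j + n).toNat), ?_, ?_⟩
  · intro i j h00 h10 h01 h11
    simp only [Set.mem_ofPred_eq] at h00 h10 h01 h11
    obtain ⟨k, l, hk, hl, -, -⟩ := hidx i j h00
    have hk1 : i + 1 + n = (k + 1 : ℕ) := by push_cast; omega
    have hl1 : j + 1 + n = (l + 1 : ℕ) := by push_cast; omega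
    obtain ⟨x00, b00⟩ := hx i j k l h00 hk hl
    obtain ⟨x10, b10⟩ := hx _ _ _ _ h10 hk1 hl
    obtain ⟨x01, b01⟩ := hx _ _ _ _ h01 hk hl1
    obtain ⟨x11, b11⟩ := hx _ _ _ _ h11 hk1 hl1
    simp only [hk, hl, hk1, hl1, Int.toNat_natCast]
    rw [← hgf' _ x00, ← hgf' _ x10, ← hgf' _ x01, ← hgf' _ x11]
    obtain ⟨v00, v10, v11, v01⟩ := quadVertex_cellData h b k l (w k l) (w (k + 1) l) (w k (l + 1))
      (w (k + 1) (l + 1))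
    set q := cellData h (cellCenter b h k l) (w k l) (w (k + 1) l) (w k (l + 1))
      (w (k + 1) (l + 1)) with hq
    obtain ⟨n00, E₁, E₂, d1, d3⟩ := hw k l b00
    obtain ⟨n10, -, -, d2, -⟩ := hw (k + 1) l b10
    obtain ⟨n01, -, -, -, d4⟩ := hw k (l + 1) b01
    have := hcirc q ?_ ?_ ?_ ?_
    · rwa [v00, v10, v11, v01] at this
    · have hc := convex_closedUnitDisc
      rw [quadVertex_sum q, v00, v10, v11, v01]
      exact hc (hc (unitDisc_subset x00) (unitDisc_subset x10) (by norm_num) (by norm_num)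
        (by norm_num)) (hc (unitDisc_subset x11) (unitDisc_subset x01) (by norm_num) (by norm_num)
        (by norm_num)) (by norm_num) (by norm_num) (by norm_num)
    · have hd := dist_cellData_squareData_le (c := cellCenter b h k l) hhpos.le (by linarith)
        n00 n10 n01 (hw _ _ b11).1 d1 d2 d3 d4
      have hhr : h * K + h * K ≤ r := by
        have := mul_le_mul_of_nonneg_right hhε hK0.le
        linarith
      refine (dist_cellData_squareData_zero_le hhpos.le _ _ _ _ _).trans (max_le (hd.trans hhr) ?_)
      have := le_mul_of_one_le_right hhpos.le hK1
      linarith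
    -- The lattice equation multiplied by `h / 4` is exactly `V.1 = h ^ 2 * R₁`; the next case is
    -- the same for `U.2`.
    · rw [← hq] at E₁
      have : q.1.2.2.1.1 = h / 4 * ((w (k + 1) (l + 1)).1 + (w k (l + 1)).1 - (w (k + 1) l).1
          - (w k l).1) := by
        simp only [hq, cellData, Prod.fst_add, Prod.fst_sub, Prod.smul_fst, smul_eq_mul]
        ring
      rw [this, E₁, show q.2 = h from rfl]; ring
    · rw [← hq] at E₂
      have : q.1.2.1.2 = h / 4 * ((w (k + 1) (l + 1)).2 + (w (k + 1) l).2 - (w k (l + 1)).2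
          - (w k l).2) := by
        simp only [hq, cellData, Prod.snd_add, Prod.snd_sub, Prod.smul_snd, smul_eq_mul]
        ring
      rw [this, E₂, show q.2 = h from rfl]; ring
  · intro i j hij
    obtain ⟨k, l, hk, hl, hkl, hgrid⟩ := hidx i j hij
    obtain ⟨hxd, -⟩ := hx i j k l hij hk hl
    simp only [hk, hl, Int.toNat_natCast]
    refine ⟨⟨_, hxd, rfl⟩, ?_⟩
    rw [← hgf' _ hij, ← hgf' _ hxd]
    refine (hL.dist_le_mul _ (unitDisc_subset hij) _ (unitDisc_subset hxd)).trans ?_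
    have hnorm : ‖gridPoint p₀ ε i j‖ ≤ 1 := by
      rw [Prod.norm_def]
      exact max_le (habs _ hij).1 (habs _ hij).2
    have hdist : dist (gridPoint p₀ ε i j) (x k l) ≤ 4 * δ + δ := by
      rw [dist_eq_norm]
      simp only [x, hgrid]
      have : gridPoint p₀ ε i j - (ρ • gridPoint p₀ ε i j + h ^ 2 • w k l) =
          (4 * δ) • gridPoint p₀ ε i j - h ^ 2 • w k l := by
        rw [hρ]; module
      rw [this]
      refine (norm_sub_le _ _).trans (add_le_add ?_ (hdisp k l hkl))
      rw [norm_smul, Real.norm_eq_abs, abs_of_pos (by positivity)]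
      exact mul_le_of_le_one_right (by positivity) hnorm
    have := mul_le_mul_of_nonneg_left hdist hL0
    have e : (L : ℝ) * (4 * δ + δ) = L * (5 / 4 * K) * ε ^ 2 := by rw [hδ]; ring
    nlinarith [sq_nonneg ε]
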